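/- Let $M$ be a connected smooth manifold (Hausdorff, $\sigma$-compact) of dimension $m>2$ with a smooth symmetric $(0,2)$-tensor field $g=\langle\cdot,\cdot\rangle$, and let $\Sigma\neq\emptyset$ be the set of points where $g$ is degenerate. Assume that in every local coordinate system the function $\det(g_{ab})$ has non-zero differential at the points of $\Sigma$ (so that $\Sigma$ is a smooth hypersurface and the radical $\mathrm{Rad}_p\subset T_pM$ is one-dimensional for $p\in\Sigma$), that $\mathrm{Rad}_p\subset T_p\Sigma$ for all $p\in\Sigma$, and that $g$ changes from Riemannian to Lorentzian (signature $(-,+,\dots,+)$) across $\Sigma$ ("transverse Riemann-Lorentz space with tangent radical"). Let $\nabla$ be the Levi-Civita connection on $M-\Sigma$, $R(\mathcal A,\mathcal B)\mathcal C=\nabla_{\mathcal A}\nabla_{\mathcal B}\mathcal C-\nabla_{\mathcal B}\nabla_{\mathcal A}\mathcal C-\nabla_{[\mathcal A,\mathcal B]}\mathcal C$ its curvature, and let $\square$ be the dual connection on $M$, defined by the Koszul formula $$2\,\square_{\mathcal A}\mathcal B(\mathcal C)=\mathcal A\langle\mathcal B,\mathcal C\rangle+\mathcal B\langle\mathcal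 C,\mathcal A\rangle-\mathcal C\langle\mathcal A,\mathcal B\rangle+\langle[\mathcal A,\mathcal B],\mathcal C\rangle-\langle[\mathcal B,\mathcal C],\mathcal A\rangle+\langle[\mathcal C,\mathcal A],\mathcal B\rangle .$$ At $p\in\Sigma$, if $r\in\mathrm{Rad}_p$, then $II_r(a,b)=\square_{\mathcal A}\mathcal B(\mathcal R)(p)$ depends only on the values $a,b,r$ at $p$ of $\mathcal A,\mathcal B,\mathcal R$. The main normal $N$ (unique) and the main radical vector $R$ (unique up to sign) at $p$ are defined by: $N\perp T_p\Sigma$, $\langle N,N\rangle=1$, $R\in \mathrm{Rad}_p$, $II_R(N,N)=0$, and $\mathcal H(R,R)=-1$, where $\mathcal H(x,R)=-\square_xN(R)=-II_R(x,N)$. Write $II=II_R$. For $a\in T_pM$ put $\nu(a)=\langle a,N\rangle$ and $\rho(a)=-\mathcal H(a-\nu(a)N,R)$, and for $a,b,c,d\in T_pM$ $$\Upsilon(a,b,c,d)=\det\begin{pmatrix} II(a,c)& II(a,d)\\ II(b,c)& II(b,d)\end{pmatrix}.$$ $\Sigma$ is called $II$-flat if $II(v,w)=0$ for all $p\in\Sigma$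 and all $v,w$ in the screen $S_p=\{v\in T_p\Sigma:\mathcal H(v,R)=0\}$. For smooth vector fields $A,B,C,D$ along $\Sigma$ (smooth sections of $TM|_\Sigma$), one says that $\langle R(A,B)C,D\rangle$ is well-defined if for all smooth extensions $\mathcal A,\mathcal B,\mathcal C,\mathcal D$ of $A,B,C,D$ to $M$ the function $\langle R(\mathcal A,\mathcal B)\mathcal C,\mathcal D\rangle$ on $M-\Sigma$ extends smoothly to $M$, and the restriction to $\Sigma$ of this smooth extension does not depend on the chosen extensions. **Theorem.** (0) $\Upsilon$ is the restriction to $\Sigma$ of the smooth extension of $\tau\,\langle R(\cdot,\cdot)\cdot,\cdot\rangle$: if $\mathcal R$ is a smooth vector field on an open set $U\subset M$ whose value at each point of $U\cap\Sigma$ is a main radical vector, and $\tau=\langle\mathcal R,\mathcal R\rangle$, then for all smooth vector fields $\mathcal A,\mathcal B,\mathcal C,\mathcal D$ on $M$ the function $\tau\,\langle R(\mathcal A,\mathcal B)\mathcal C,\mathcal D\rangle$ on $U-\Sigma$ extends to a smooth function on $U$ which equals $\Upsilon(\mathcal A,\mathcal B,\mathcal C,\mathcal D)$ on $U\cap\Sigma$.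 Let $A,B,C,D$ be smooth vector fields along $\Sigma$. (1) $\langle R(A,B)C,D\rangle$ is well-defined if and only if $$\Upsilon(\cdot,B,C,D)=\Upsilon(A,\cdot,C,D)=\Upsilon(A,B,\cdot,D)=\Upsilon(A,B,C,\cdot)=0$$ at every point of $\Sigma$ (the free slot running over all tangent vectors of $M$ at the point). (2) If $\Sigma$ is $II$-flat, then $\langle R(A,B)C,D\rangle$ is well-defined if and only if at every point of $\Sigma$ either $$\det\begin{pmatrix}\nu(A)&\nu(B)\\ \rho(A)&\rho(B)\end{pmatrix}=0=\det\begin{pmatrix}\nu(C)&\nu(D)\\ \rho(C)&\rho(D)\end{pmatrix}$$ or one of these two matrices is the zero matrix. -/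

import Mathlib

open scoped Manifold ContDiff Topology
open Bundle

namespace SingularMetric

noncomputable section

/-- A smooth symmetric `(0,2)`-tensor field on an `m`-dimensional manifold, possibly degenerate. -/
structure SymTensor (m : ℕ) (M : Type*) [TopologicalSpace M]
    [ChartedSpace (EuclideanSpace ℝ (Fin m)) M] [IsManifold (𝓡 m) ∞ M] where
  /-- the value of the tensor field at each point -/
  toFun : ∀ p : M, TangentSpace (𝓡 m) p →L[ℝ] TangentSpace (𝓡 m) p →L[ℝ] ℝ
  symm : ∀ (p : M) (v w : TangentSpace (𝓡 m) p), toFun p v w = toFun p w v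
  smooth : ContMDiff (𝓡 m)
    ((𝓡 m).prod 𝓘(ℝ, EuclideanSpace ℝ (Fin m) →L[ℝ] EuclideanSpace ℝ (Fin m) →L[ℝ] ℝ)) ∞
    (fun p : M => TotalSpace.mk'
      (EuclideanSpace ℝ (Fin m) →L[ℝ] EuclideanSpace ℝ (Fin m) →L[ℝ] ℝ) p (toFun p))

section

variable {m : ℕ} {M : Type*} [TopologicalSpace M]
  [ChartedSpace (EuclideanSpace ℝ (Fin m)) M] [IsManifold (𝓡 m) ∞ M]

/-- `A` is a smooth vector field on the set `U`. -/
def SmoothFieldOn (U : Set M) (A : ∀ p : M, TangentSpace (𝓡 m) p) : Prop :=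
  ContMDiffOn (𝓡 m) ((𝓡 m).prod 𝓘(ℝ, EuclideanSpace ℝ (Fin m))) ∞
    (fun p : M => TotalSpace.mk' (EuclideanSpace ℝ (Fin m)) p (A p)) U

/-- `A` is a smooth vector field on `M`. -/
def SmoothField (A : ∀ p : M, TangentSpace (𝓡 m) p) : Prop :=
  ContMDiff (𝓡 m) ((𝓡 m).prod 𝓘(ℝ, EuclideanSpace ℝ (Fin m))) ∞
    (fun p : M => TotalSpace.mk' (EuclideanSpace ℝ (Fin m)) p (A p))

/-- `A` is differentiable at `p` (as a vector field). -/
def DiffFieldAt (A : ∀ p : M, TangentSpace (𝓡 m) p) (p : M) : Prop :=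
  MDifferentiableAt (𝓡 m) ((𝓡 m).prod 𝓘(ℝ, EuclideanSpace ℝ (Fin m)))
    (fun q : M => TotalSpace.mk' (EuclideanSpace ℝ (Fin m)) q (A q)) p

variable (g : SymTensor m M)

/-! ### Transverse singular spaces with tangent radical -/

/-- The radical of `g` at `p`. -/
def radical (p : M) : Submodule ℝ (TangentSpace (𝓡 m) p) where
  carrier := {v | ∀ w, g.toFun p v w = 0}
  add_mem' := by
    intro a b ha hb w
    have h1 := ha w
    have h2 := hb w
    simp [h1, h2]
  zero_mem' := by intro w; simp
  smul_mem' := by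
    intro c x hx w
    have h1 := hx w
    simp [h1]

/-- The singular set `Σ`: the points at which `g` is degenerate. -/
def singularSet : Set M := {p | radical g p ≠ ⊥}

/-- The function `det (g_ab)` in the coordinates given by the chart `e`. -/
def coordDet (e : OpenPartialHomeomorph M (EuclideanSpace ℝ (Fin m)))
    (x : EuclideanSpace ℝ (Fin m)) : ℝ :=
  Matrix.det (Matrix.of fun a b : Fin m =>
    g.toFun (e.symm x)
      (mfderiv 𝓘(ℝ, EuclideanSpace ℝ (Fin m)) (𝓡 m) e.symm x (EuclideanSpace.single a (1 : ℝ)))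
      (mfderiv 𝓘(ℝ, EuclideanSpace ℝ (Fin m)) (𝓡 m) e.symm x (EuclideanSpace.single b (1 : ℝ))))

/-- The tangent space of the hypersurface `Σ` at `p`: the vectors annihilated by the differentials
of all smooth functions that vanish on `Σ`. -/
def tangentSigma (p : M) : Submodule ℝ (TangentSpace (𝓡 m) p) where
  carrier := {v | ∀ f : M → ℝ, ContMDiff (𝓡 m) 𝓘(ℝ, ℝ) ∞ f →
    (∀ q ∈ singularSet g, f q = 0) → mvfderiv (𝓡 m) f p v = 0}
  add_mem' := by
    intro a b ha hb f hf h0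
    rw [map_add, ha f hf h0, hb f hf h0, add_zero]
  zero_mem' := by intro f _ _; exact map_zero _
  smul_mem' := by
    intro c x hx f hf h0
    rw [map_smul, hx f hf h0, smul_zero]

/-- `g` is positive definite at `p`. -/
def IsRiemannianAt (p : M) : Prop :=
  ∀ v : TangentSpace (𝓡 m) p, v ≠ 0 → 0 < g.toFun p v v

/-- `g` is Lorentzian at `p`, i.e. it has signature `(-,+,…,+)`: there is a negative vector whose
orthogonal complement is positive definite. -/
def IsLorentzianAt (p : M) : Prop :=
  ∃ u : TangentSpace (𝓡 m) p, g.toFun p u u < 0 ∧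
    ∀ v : TangentSpace (𝓡 m) p, g.toFun p u v = 0 → v ≠ 0 → 0 < g.toFun p v v

/-- `(M,g)` is a transverse Riemann-Lorentz space with tangent radical. -/
structure IsTransverseRiemannLorentz : Prop where
  nonempty : (singularSet g).Nonempty
  /-- in every local coordinate system `det (g_ab)` has nonzero differential on `Σ` -/
  transverse : ∀ e ∈ IsManifold.maximalAtlas (𝓡 m) ∞ M, ∀ p ∈ e.source, p ∈ singularSet g →
    fderiv ℝ (coordDet g e) (e p) ≠ 0
  /-- the radical is tangent to `Σ` -/
  tangent : ∀ p ∈ singularSet g, radical g p ≤ tangentSigma g p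
  /-- off `Σ` the metric is Riemannian or Lorentzian … -/
  riemann_or_lorentz : ∀ p ∉ singularSet g, IsRiemannianAt g p ∨ IsLorentzianAt g p
  /-- … and it changes from one type to the other across `Σ` -/
  changes : ∀ p ∈ singularSet g,
    p ∈ closure {q | IsRiemannianAt g q} ∧ p ∈ closure {q | IsLorentzianAt g q}

/-! ### Dual connection, Levi-Civita connection and curvature -/

/-- The function `⟨A,B⟩`. -/
def pair (A B : ∀ p : M, TangentSpace (𝓡 m) p) (p : M) : ℝ := g.toFun p (A p) (B p)

/-- The dual connection `□_A B (C)`, given by the Koszul formula; it makes sense on all of `M`. -/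
def dualConn (A B C : ∀ p : M, TangentSpace (𝓡 m) p) (p : M) : ℝ :=
  (1 / 2 : ℝ) *
    (mvfderiv (𝓡 m) (pair g B C) p (A p) + mvfderiv (𝓡 m) (pair g C A) p (B p)
      - mvfderiv (𝓡 m) (pair g A B) p (C p)
      + g.toFun p (VectorField.mlieBracket (𝓡 m) A B p) (C p)
      - g.toFun p (VectorField.mlieBracket (𝓡 m) B C p) (A p)
      + g.toFun p (VectorField.mlieBracket (𝓡 m) C A p) (B p))

/-- The Levi-Civita connection of `g` off `Σ`: `∇_A B (p)` is the (by nondegeneracy unique) vector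
`v` at `p` with `⟨v, C(p)⟩ = □_A B (C) (p)` for all vector fields `C` differentiable at `p`.
At points of `Σ` the value is meaningless and never used. -/
def leviCivita (A B : ∀ p : M, TangentSpace (𝓡 m) p) (p : M) : TangentSpace (𝓡 m) p :=
  Classical.epsilon fun v : TangentSpace (𝓡 m) p =>
    ∀ C : ∀ q : M, TangentSpace (𝓡 m) q, DiffFieldAt C p →
      g.toFun p v (C p) = dualConn g A B C p

/-- The covariant curvature `⟨R(A,B)C,D⟩` of the Levi-Civita connection off `Σ`, where
`R(A,B)C = ∇_A ∇_B C - ∇_B ∇_A C - ∇_[A,B] C`. -/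
def curvature (A B C D : ∀ p : M, TangentSpace (𝓡 m) p) (p : M) : ℝ :=
  g.toFun p
    (leviCivita g A (leviCivita g B C) p - leviCivita g B (leviCivita g A C) p
      - leviCivita g (VectorField.mlieBracket (𝓡 m) A B) C p) (D p)

/-! ### The canonical objects along `Σ` -/

/-- `II_r(a,b) = □_A B (R) (p)`, where `A, B, R` are local vector fields extending the tangent
vectors `a, b, r` at `p`. For `p ∈ Σ` and `r` in the radical this does not depend on the choice
of the extensions. -/
def II {p : M} (r a b : TangentSpace (𝓡 m) p) : ℝ :=
  dualConn g (FiberBundle.extend (EuclideanSpace ℝ (Fin m)) a)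
    (FiberBundle.extend (EuclideanSpace ℝ (Fin m)) b)
    (FiberBundle.extend (EuclideanSpace ℝ (Fin m)) r) p

/-- `𝓗_n(x,r) = - □_x N (r)`, the second fundamental form `𝓗_N(X,Y) = - □_X N (Y)` of `Σ` at `p`
with respect to a normal `N`, `N(p) = n`, when the second argument `r` is radical (so that the
value depends only on `n`). -/
def HRad {p : M} (n x r : TangentSpace (𝓡 m) p) : ℝ := -II g r x n

/-- `n` and `r` are the values at `p ∈ Σ` of the main normal `N` and of the main radical vector
field `R` (`N` is unique, `R` is unique up to sign). -/
structure IsMainPair {p : M} (n r : TangentSpace (𝓡 m) p) : Prop where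
  normal : ∀ v ∈ tangentSigma g p, g.toFun p n v = 0
  unit : g.toFun p n n = 1
  radical : r ∈ radical g p
  isotropic : II g r n n = 0
  normalized : HRad g n r r = -1

/-- The canonical screen `S_p = {v ∈ T_pΣ : 𝓗(v,R) = 0}`. -/
def screen {p : M} (n r : TangentSpace (𝓡 m) p) : Set (TangentSpace (𝓡 m) p) :=
  {v | v ∈ tangentSigma g p ∧ HRad g n v r = 0}

/-- `Σ` is `II`-flat: `II` vanishes on the canonical screen distribution. -/
def IIFlat : Prop :=
  ∀ p ∈ singularSet g, ∀ n r : TangentSpace (𝓡 m) p, IsMainPair g n r →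
    ∀ v ∈ screen g n r, ∀ w ∈ screen g n r, II g r v w = 0

/-- The normal component `ν(a) = ⟨a,N⟩`. -/
def nu {p : M} (n a : TangentSpace (𝓡 m) p) : ℝ := g.toFun p a n

/-- The radical component `ρ(a) = -𝓗(a - ν(a)N, R)`. -/
def rho {p : M} (n r a : TangentSpace (𝓡 m) p) : ℝ := -HRad g n (a - nu g n a • n) r

/-- The matrix of `(ν,ρ)`-components of a pair of tangent vectors. -/
def nuRhoMatrix {p : M} (n r a b : TangentSpace (𝓡 m) p) : Matrix (Fin 2) (Fin 2) ℝ :=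
  !![nu g n a, nu g n b; rho g n r a, rho g n r b]

/-- The tensor `Υ` along `Σ`, where `r` is the main radical vector at `p ∈ Σ`. -/
def Upsilon {p : M} (r a b c d : TangentSpace (𝓡 m) p) : ℝ :=
  Matrix.det !![II g r a c, II g r a d; II g r b c, II g r b d]

/-! ### Vector fields along `Σ` and their extensions -/

/-- `A` is a smooth vector field along `Σ` (not necessarily tangent to `Σ`): locally it is the
restriction of a smooth vector field of `M`. -/
def SmoothAlong (A : ∀ p : singularSet g, TangentSpace (𝓡 m) (p : M)) : Prop :=
  ∀ p : singularSet g, ∃ U : Set M, IsOpen U ∧ (p : M) ∈ U ∧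
    ∃ A' : ∀ q : M, TangentSpace (𝓡 m) q, SmoothFieldOn U A' ∧
      ∀ q : singularSet g, (q : M) ∈ U → A' q = A q

/-- The smooth vector field `A'` on `M` is an extension of `A`. -/
def IsExtension (A' : ∀ q : M, TangentSpace (𝓡 m) q)
    (A : ∀ p : singularSet g, TangentSpace (𝓡 m) (p : M)) : Prop :=
  SmoothField A' ∧ ∀ q : singularSet g, A' q = A q

/-- `⟨R(A,B)C,D⟩` is well-defined: for all extensions the curvature function on `M - Σ` extends
smoothly to `M`, and the restriction to `Σ` of this smooth extension does not depend on the chosen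
extensions of `A, B, C, D`. -/
def CurvatureWellDefined (A B C D : ∀ p : singularSet g, TangentSpace (𝓡 m) (p : M)) : Prop :=
  ∃ L : singularSet g → ℝ, ∀ A' B' C' D' : ∀ q : M, TangentSpace (𝓡 m) q,
    IsExtension g A' A → IsExtension g B' B → IsExtension g C' C → IsExtension g D' D →
    ∃ F : M → ℝ, ContMDiff (𝓡 m) 𝓘(ℝ, ℝ) ∞ F ∧
      (∀ q, q ∉ singularSet g → F q = curvature g A' B' C' D' q) ∧
      ∀ q : singularSet g, F q = L q

end

end

end SingularMetric

namespace SingularMetric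

/-! ### Parametric integrals and division by a defining function -/

/-! In a coordinate frame let `G` be the Gram matrix of `g`. Then `Σ` is the zero set of `det G`,
and transversality says that `d(det G) ≠ 0` there. So every smooth function vanishing on `Σ` is
locally a smooth multiple of `det G` (Hadamard division, `exists_eq_mul_of_mvfderiv_ne_zero`).

Metric compatibility writes the curvature off `Σ` as smooth terms in the dual connection plus `⟨∇_A
C, ∇_B D⟩ - ⟨∇_B C, ∇_A D⟩` (`curvature_eq`). Only this difference is singular, through `G⁻¹ = (det
G)⁻¹ adj G`. Hence `det G` times the curvature extends smoothly: this is `scaledCurvature`. At a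
point of `Σ` with radical vector `r ≠ 0` one has `adj G = c r rᵀ`, so the extension takes the value
`c Υ` (`scaledCurvature_eq_Upsilon`). The same `c` satisfies `d(det G)(v) = 2c II_r(v,r)`
(`exists_adjugate_gram_eq`), so transversality gives `c ≠ 0`. Comparing with `dτ(v) = 2 II_r(v,r)`
for `τ = ⟨R,R⟩ = h det G` gives `h c = 1`, which is (0).

For (1), the curvature is tensorial off `Σ`, and two extensions of one field along `Σ` differ near
`Σ` by `det G` times a smooth field `Y`. Exchanging them changes the curvature by the scaled
curvature with `Y` in that slot, whose value on `Σ` is `c Υ(Y, …)`, with `Y` arbitrary. Independence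
of the extension is therefore the vanishing of `Υ` with a free slot
(`IsTensorialOff.eq_zero_of_extension`, `IsTensorialOff.eq_of_extension`). The same vanishing lets
the scaled curvature be divided by `det G`, which yields the smooth extension.

For (2), `II`-flatness forces `II = ν ⊗ ρ + ρ ⊗ ν`, so `Υ` is minus the product of the two `(ν,ρ)`
determinants. Putting `N` and `R` in the free slot reads off the entries of the matrices. -/

theorem hasFDerivAt_parametric_intervalIntegral {E F : Type*} [NormedAddCommGroup E]
    [NormedSpace ℝ E] [FiniteDimensional ℝ E] [NormedAddCommGroup F] [NormedSpace ℝ F]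
    [CompleteSpace F] {G : E × ℝ → F} (hG : ContDiff ℝ 1 G) (x₀ : E) :
    HasFDerivAt (fun x => ∫ s in (0 : ℝ)..1, G (x, s))
      (∫ s in (0 : ℝ)..1, (fderiv ℝ G (x₀, s)).comp (ContinuousLinearMap.inl ℝ E ℝ)) x₀ := by
  have hG' : Continuous fun z : E × ℝ =>
      (fderiv ℝ G z).comp (ContinuousLinearMap.inl ℝ E ℝ) :=
    (hG.continuous_fderiv one_ne_zero).clm_comp continuous_const
  -- The dominating function is a constant: the derivative is continuous, hence bounded on a compact
  -- neighbourhood of `{x₀} × [0,1]`.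
  have hK : IsCompact (Metric.closedBall x₀ 1 ×ˢ Set.Icc (0 : ℝ) 1) :=
    (isCompact_closedBall x₀ 1).prod isCompact_Icc
  obtain ⟨C, hC⟩ := hK.exists_bound_of_continuousOn hG'.continuousOn
  refine intervalIntegral.hasFDerivAt_integral_of_dominated_of_fderiv_le
    (F := fun x s => G (x, s))
    (F' := fun x s => (fderiv ℝ G (x, s)).comp (ContinuousLinearMap.inl ℝ E ℝ))
    (bound := fun _ => C) (Metric.closedBall_mem_nhds x₀ one_pos) ?_ ?_ ?_ ?_ ?_ ?_
  · exact Filter.Eventually.of_forall fun x =>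
      (hG.continuous.comp (by fun_prop : Continuous fun s : ℝ => (x, s))).aestronglyMeasurable
  · exact (hG.continuous.comp
      (by fun_prop : Continuous fun s : ℝ => (x₀, s))).intervalIntegrable _ _
  · exact (hG'.comp (by fun_prop : Continuous fun s : ℝ => (x₀, s))).aestronglyMeasurable
  · refine Filter.Eventually.of_forall fun s hs x hx => hC (x, s) ⟨hx, ?_⟩
    rw [Set.uIoc_of_le zero_le_one] at hs
    exact ⟨hs.1.le, hs.2⟩
  · exact intervalIntegrable_const
  · refine Filter.Eventually.of_forall fun s _ x _ => ?_
    have h1 : HasFDerivAt G (fderiv ℝ G (x, s)) (x, s) :=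
      (hG.differentiable one_ne_zero _).hasFDerivAt
    have h2 : HasFDerivAt (fun x : E => (x, s)) (ContinuousLinearMap.inl ℝ E ℝ) x :=
      hasFDerivAt_prodMk_left x s
    exact h1.comp x h2

/-- The induction quantifies over the target `F`, because the derivative is again such an integral
with values in `E →L[ℝ] F`. -/
theorem contDiff_nat_parametric_intervalIntegral {E : Type} [NormedAddCommGroup E]
    [NormedSpace ℝ E] [FiniteDimensional ℝ E] (n : ℕ) :
    ∀ {F : Type} [NormedAddCommGroup F] [NormedSpace ℝ F] [CompleteSpace F] {G : E × ℝ → F},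
      ContDiff ℝ ∞ G → ContDiff ℝ n (fun x => ∫ s in (0 : ℝ)..1, G (x, s)) := by
  induction n with
  | zero =>
    intro F _ _ _ G hG
    refine contDiff_zero.2 ?_
    exact intervalIntegral.continuous_parametric_intervalIntegral_of_continuous'
      (f := fun x s => G (x, s)) hG.continuous 0 1
  | succ n ih =>
    intro F _ _ _ G hG
    refine contDiff_succ_iff_hasFDerivAt.2 ⟨_, ?_, fun x =>
      hasFDerivAt_parametric_intervalIntegral (hG.of_le (by simp)) x⟩
    refine ih (G := fun z => (fderiv ℝ G z).comp (ContinuousLinearMap.inl ℝ E ℝ)) ?_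
    exact (hG.fderiv_right (m := ∞) (by simp)).clm_comp contDiff_const

theorem contDiff_parametric_intervalIntegral {E F : Type} [NormedAddCommGroup E]
    [NormedSpace ℝ E] [FiniteDimensional ℝ E] [NormedAddCommGroup F] [NormedSpace ℝ F]
    [CompleteSpace F] {G : E × ℝ → F} (hG : ContDiff ℝ ∞ G) :
    ContDiff ℝ ∞ (fun x => ∫ s in (0 : ℝ)..1, G (x, s)) :=
  contDiff_infty.2 fun n => contDiff_nat_parametric_intervalIntegral n hG

/-- A smooth function vanishing on the kernel of a linear form is divisible by that form. -/
theorem exists_eq_mul_linear {E : Type} [NormedAddCommGroup E] [NormedSpace ℝ E]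
    [FiniteDimensional ℝ E] {F : E → ℝ} (hF : ContDiff ℝ ∞ F) (l : E →L[ℝ] ℝ) {v : E}
    (hv : l v = 1) (h0 : ∀ y, l y = 0 → F y = 0) :
    ∃ H : E → ℝ, ContDiff ℝ ∞ H ∧ ∀ y, F y = H y * l y := by
  -- The fundamental theorem of calculus along the segment from `y` in direction `-v`, which ends at
  -- `y - l y • v` in the kernel of `l`, where `F` vanishes.
  refine ⟨fun y => ∫ s in (0 : ℝ)..1, fderiv ℝ F (y - (s * l y) • v) v, ?_, fun y => ?_⟩
  · refine contDiff_parametric_intervalIntegral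
      (G := fun z : E × ℝ => fderiv ℝ F (z.1 - (z.2 * l z.1) • v) v) ?_
    refine ContDiff.clm_apply ?_ contDiff_const
    refine (hF.fderiv_right (m := ∞) (by simp)).comp ?_
    fun_prop
  · have hd : ∀ s : ℝ, HasDerivAt (fun s : ℝ => F (y - (s * l y) • v))
        (-(fderiv ℝ F (y - (s * l y) • v) v * l y)) s := by
      intro s
      have h1 : HasFDerivAt F (fderiv ℝ F (y - (s * l y) • v)) (y - (s * l y) • v) :=
        (hF.differentiable (by simp) _).hasFDerivAt
      have h2 : HasDerivAt (fun s : ℝ => y - (s * l y) • v) (-(l y • v)) s := by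
        have := (((hasDerivAt_id s).mul_const (l y)).smul_const v).const_sub y
        simpa using this
      exact (h1.comp_hasDerivAt s h2).congr_deriv (by simp [mul_comm])
    have hc : Continuous fun s : ℝ => -(fderiv ℝ F (y - (s * l y) • v) v * l y) := by
      have h3 : Continuous (fderiv ℝ F) := hF.continuous_fderiv (by simp)
      have h4 : Continuous fun s : ℝ => fderiv ℝ F (y - (s * l y) • v) :=
        h3.comp (by fun_prop)
      fun_prop
    have hI := intervalIntegral.integral_eq_sub_of_hasDerivAt (a := 0) (b := 1)
      (fun s _ => hd s) (hc.intervalIntegrable _ _)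
    have hz : F (y - l y • v) = 0 := h0 _ (by simp [hv])
    rw [intervalIntegral.integral_neg, intervalIntegral.integral_mul_const] at hI
    simp only [one_mul, zero_mul, zero_smul, sub_zero, hz] at hI
    linarith

theorem exists_eq_mul_linear_local {E : Type} [NormedAddCommGroup E] [NormedSpace ℝ E]
    [FiniteDimensional ℝ E] {F : E → ℝ} {W : Set E} (hW : IsOpen W) (h0W : (0 : E) ∈ W)
    (hF : ContDiffOn ℝ ∞ F W) (l : E →L[ℝ] ℝ) {v : E}
    (hv : l v = 1) (h0 : ∀ y ∈ W, l y = 0 → F y = 0) :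
    ∃ H : E → ℝ, ContDiff ℝ ∞ H ∧ ∃ V : Set E, IsOpen V ∧ (0 : E) ∈ V ∧
      ∀ y ∈ V, F y = H y * l y := by
  obtain ⟨ε, hε, hεW⟩ := Metric.isOpen_iff.1 hW 0 h0W
  let χ : ContDiffBump (0 : E) := ⟨ε / 4, ε / 2, by positivity, by linarith⟩
  have hsupp : tsupport χ ⊆ W := by
    rw [χ.tsupport_eq]
    exact (Metric.closedBall_subset_ball (by simp [χ]; linarith)).trans hεW
  have hχF : ContDiff ℝ ∞ fun y => χ y * F y := by
    refine contDiff_iff_contDiffAt.2 fun y => ?_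
    by_cases hy : y ∈ W
    · exact χ.contDiff.contDiffAt.mul (hF.contDiffAt (hW.mem_nhds hy))
    · have : y ∉ tsupport χ := fun h => hy (hsupp h)
      refine contDiffAt_const (c := (0 : ℝ)) |>.congr_of_eventuallyEq ?_
      filter_upwards [notMem_tsupport_iff_eventuallyEq.1 this] with z hz
      simp [hz]
  obtain ⟨H, hH, hHF⟩ := exists_eq_mul_linear hχF l hv (fun y hy => by
    by_cases hyW : y ∈ W
    · simp [h0 y hyW hy]
    · have : χ y = 0 := image_eq_zero_of_notMem_tsupport fun h => hyW (hsupp h)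
      simp [this])
  refine ⟨H, hH, Metric.ball 0 (ε / 4), Metric.isOpen_ball, by simp; positivity, fun y hy => ?_⟩
  rw [← hHF y, χ.one_of_mem_closedBall (Metric.ball_subset_closedBall hy), one_mul]

/-- Hadamard division: a smooth function that vanishes on the zero set of `φ` is a smooth multiple
of `φ` near every zero of `φ` at which `φ` has nonzero differential. -/
theorem exists_eq_mul_of_fderiv_ne_zero {E : Type} [NormedAddCommGroup E] [NormedSpace ℝ E]
    [FiniteDimensional ℝ E] {f φ : E → ℝ} {U : Set E} (hU : IsOpen U) {x₀ : E} (hx₀ : x₀ ∈ U)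
    (hf : ContDiffOn ℝ ∞ f U) (hφ : ContDiffOn ℝ ∞ φ U) (hφ0 : φ x₀ = 0)
    (hd : fderiv ℝ φ x₀ ≠ 0) (h0 : ∀ x ∈ U, φ x = 0 → f x = 0) :
    ∃ V : Set E, IsOpen V ∧ x₀ ∈ V ∧ V ⊆ U ∧
      ∃ h : E → ℝ, ContDiffOn ℝ ∞ h V ∧ ∀ x ∈ V, f x = h x * φ x := by
  set l := fderiv ℝ φ x₀ with hl
  obtain ⟨w, hw⟩ : ∃ w, l w ≠ 0 := by
    by_contra! h
    exact hd (ContinuousLinearMap.ext h)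
  set v := (l w)⁻¹ • w
  have hv : l v = 1 := by simp [v, hw]
  -- `Ψ` straightens the zero set: `l ∘ Ψ = φ`, `Ψ x₀ = 0`, and its derivative at `x₀` is the
  -- identity. Division by `φ` becomes division by `l` in the new coordinates.
  let Ψ : E → E := fun x => (x - x₀) + (φ x - l (x - x₀)) • v
  have hΨ : ContDiffOn ℝ ∞ Ψ U := by
    refine ContDiffOn.add (by fun_prop) (ContDiffOn.smul (hφ.sub (by fun_prop)) contDiffOn_const)
  have hΨ0 : Ψ x₀ = 0 := by simp [Ψ, hφ0]
  have hlΨ : ∀ x, l (Ψ x) = φ x := by intro x; simp [Ψ, hv]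
  have hΨa : ContDiffAt ℝ ∞ Ψ x₀ := hΨ.contDiffAt (hU.mem_nhds hx₀)
  have hφd : HasFDerivAt φ l x₀ :=
    ((hφ.contDiffAt (hU.mem_nhds hx₀)).differentiableAt (by simp)).hasFDerivAt
  have hΨd : HasFDerivAt Ψ ((ContinuousLinearEquiv.refl ℝ E : E ≃L[ℝ] E) : E →L[ℝ] E) x₀ := by
    have h1 : HasFDerivAt (fun x : E => x - x₀) (ContinuousLinearMap.id ℝ E) x₀ :=
      (hasFDerivAt_id x₀).sub_const x₀
    have h2 : HasFDerivAt (fun x : E => l (x - x₀)) l x₀ := by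
      have := l.hasFDerivAt.comp x₀ h1
      rwa [ContinuousLinearMap.comp_id] at this
    have h3 := h1.add ((hφd.sub h2).smul_const v)
    convert! h3 using 1
    ext x
    simp
  set e := hΨa.toOpenPartialHomeomorph Ψ hΨd (by simp) with he
  have hecoe : (e : E → E) = Ψ := hΨa.toOpenPartialHomeomorph_coe hΨd (by simp)
  have hes : x₀ ∈ e.source := hΨa.mem_toOpenPartialHomeomorph_source hΨd (by simp)
  have hcont : ContinuousAt (fderiv ℝ Ψ) x₀ := by
    have : ContDiffAt ℝ ∞ (fderiv ℝ Ψ) x₀ := hΨa.fderiv_right (by simp)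
    exact this.continuousAt
  -- Smoothness of the inverse is needed on a whole neighbourhood, so one restricts to points where
  -- the derivative of `Ψ` stays invertible.
  have hunit : ∀ᶠ x in 𝓝 x₀,
      fderiv ℝ Ψ x ∈ Set.range ((↑) : (E ≃L[ℝ] E) → (E →L[ℝ] E)) := by
    apply hcont
    rw [hΨd.fderiv]
    exact ContinuousLinearEquiv.nhds _
  obtain ⟨U₁, hU₁sub, hU₁, hxU₁⟩ := mem_nhds_iff.1 hunit
  let S : Set E := e.source ∩ (U ∩ U₁)
  have hS : IsOpen S := e.open_source.inter (hU.inter hU₁)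
  let W : Set E := e.target ∩ e.symm ⁻¹' (U ∩ U₁)
  have hW : IsOpen W := e.isOpen_inter_preimage_symm (hU.inter hU₁)
  have h0W : (0 : E) ∈ W := by
    have h1 : e x₀ = 0 := by rw [hecoe, hΨ0]
    refine ⟨h1 ▸ e.map_source hes, ?_⟩
    rw [← h1, Set.mem_preimage, e.left_inv hes]
    exact ⟨hx₀, hxU₁⟩
  have hF : ContDiffOn ℝ ∞ (f ∘ e.symm) W := by
    intro y hy
    have hyU : e.symm y ∈ U := hy.2.1
    obtain ⟨A, hA⟩ := hU₁sub hy.2.2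
    have h1 : ContDiffAt ℝ ∞ Ψ (e.symm y) := hΨ.contDiffAt (hU.mem_nhds hyU)
    have h2 : HasFDerivAt e (A : E →L[ℝ] E) (e.symm y) := by
      rw [hecoe, hA]
      exact (h1.differentiableAt (by simp)).hasFDerivAt
    have h3 : ContDiffAt ℝ ∞ e.symm y := e.contDiffAt_symm hy.1 h2 (by rw [hecoe]; exact h1)
    exact ((hf.contDiffAt (hU.mem_nhds hyU)).comp y h3).contDiffWithinAt
  obtain ⟨H, hH, V, hV, h0V, hHV⟩ := exists_eq_mul_linear_local hW h0W hF l hv (by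
    intro y hy hly
    refine h0 _ hy.2.1 ?_
    rw [← hlΨ, ← hecoe, e.right_inv hy.1, hly])
  have hcΨ : ContinuousOn Ψ S := (hΨ.continuousOn).mono fun x hx => hx.2.1
  refine ⟨S ∩ Ψ ⁻¹' V, hcΨ.isOpen_inter_preimage hS hV, ⟨⟨hes, hx₀, hxU₁⟩, ?_⟩,
    fun x hx => hx.1.2.1, H ∘ Ψ, ?_, fun x hx => ?_⟩
  · rw [Set.mem_preimage, hΨ0]; exact h0V
  · exact hH.comp_contDiffOn (hΨ.mono fun x hx => hx.1.2.1)
  · have := hHV (Ψ x) hx.2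
    rw [Function.comp_apply, ← hecoe, e.left_inv hx.1.1, hecoe, hlΨ] at this
    exact this

/-! ### Symmetric matrices with a kernel -/

/-- If row `j` of `G` is replaced by `r k • e_i - r i • e_k`, the vector `r` stays in the kernel. So
the determinant vanishes, and expanding it in that row gives the identity. -/
theorem adjugate_mul_eq_of_mulVec_eq_zero {ι : Type*} [Fintype ι] [DecidableEq ι]
    {G : Matrix ι ι ℝ} {r : ι → ℝ} (hr : r ≠ 0) (h : G.mulVec r = 0) (i j k : ι) :
    G.adjugate i j * r k = G.adjugate k j * r i := by
  have h1 : (G.updateRow j (r k • Pi.single i 1 - r i • Pi.single k 1)).det = 0 := by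
    refine Matrix.exists_mulVec_eq_zero_iff.1 ⟨r, hr, ?_⟩
    ext a
    by_cases ha : a = j
    · subst ha
      rw [Matrix.mulVec, Matrix.updateRow_self, sub_dotProduct, smul_dotProduct, smul_dotProduct,
        single_dotProduct, single_dotProduct]
      simp [mul_comm]
    · have := congrFun h a
      simpa [Matrix.mulVec, Matrix.updateRow_ne ha] using this
  rw [sub_eq_add_neg, ← neg_smul, Matrix.det_updateRow_add, Matrix.det_updateRow_smul,
    Matrix.det_updateRow_smul] at h1
  rw [Matrix.adjugate_apply, Matrix.adjugate_apply]
  linarith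

/-- The columns of the adjugate are multiples of `r` and, by symmetry, so are its rows. A kernel of
dimension greater than one is allowed; then `c = 0`. -/
theorem exists_adjugate_eq_of_mulVec_eq_zero {ι : Type*} [Fintype ι] [DecidableEq ι]
    {G : Matrix ι ι ℝ} (hG : G.IsSymm) {r : ι → ℝ} (hr : r ≠ 0) (h : G.mulVec r = 0) :
    ∃ c : ℝ, ∀ i j, G.adjugate i j = c * (r i * r j) := by
  obtain ⟨k, hk⟩ := Function.ne_iff.1 hr
  have hk' : r k ≠ 0 := hk
  have hs : ∀ i j, G.adjugate i j = G.adjugate j i := fun i j => by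
    conv_lhs => rw [← hG.eq, ← Matrix.adjugate_transpose, Matrix.transpose_apply]
  refine ⟨G.adjugate k k / (r k * r k), fun i j => ?_⟩
  have h1 := adjugate_mul_eq_of_mulVec_eq_zero hr h i j k
  have h2 := adjugate_mul_eq_of_mulVec_eq_zero hr h j k k
  rw [hs k j] at h1
  field_simp
  calc G.adjugate i j * r k ^ 2 = (G.adjugate i j * r k) * r k := by ring
    _ = (G.adjugate j k * r k) * r i := by rw [h1]; ring
    _ = _ := by rw [h2]; ring

section

variable {m : ℕ} {M : Type*} [TopologicalSpace M]
  [ChartedSpace (EuclideanSpace ℝ (Fin m)) M] [IsManifold (𝓡 m) ∞ M]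

/-- Hadamard division on a manifold. -/
theorem exists_eq_mul_of_mvfderiv_ne_zero {f φ : M → ℝ} {U : Set M} (hU : IsOpen U) {p : M}
    (hp : p ∈ U) (hf : ContMDiffOn (𝓡 m) 𝓘(ℝ, ℝ) ∞ f U)
    (hφ : ContMDiffOn (𝓡 m) 𝓘(ℝ, ℝ) ∞ φ U)
    (hd : φ p = 0 → mvfderiv (𝓡 m) φ p ≠ 0) (h0 : ∀ x ∈ U, φ x = 0 → f x = 0) :
    ∃ V : Set M, IsOpen V ∧ p ∈ V ∧ V ⊆ U ∧
      ∃ h : M → ℝ, ContMDiffOn (𝓡 m) 𝓘(ℝ, ℝ) ∞ h V ∧ ∀ x ∈ V, f x = h x * φ x := by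
  -- Where `φ p ≠ 0` the quotient `f / φ` is already smooth. Including this case makes the statement
  -- usable at every point of `M`, on `Σ` or off it.
  by_cases hp0 : φ p = 0
  · set e := extChartAt (𝓡 m) p with he
    have hmd : MDifferentiableAt (𝓡 m) 𝓘(ℝ, ℝ) φ p :=
      (hφ.contMDiffAt (hU.mem_nhds hp)).mdifferentiableAt (by simp)
    have hd' : fderiv ℝ (φ ∘ e.symm) (e p) ≠ 0 := by
      have h1 := hd hp0
      rw [hmd.mvfderiv] at h1
      simpa [writtenInExtChartAt, fderivWithin_univ] using! h1
    have hW : IsOpen (e.target ∩ e.symm ⁻¹' U) :=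
      (continuousOn_extChartAt_symm p).isOpen_inter_preimage (isOpen_extChartAt_target p) hU
    have hc : ∀ {k : M → ℝ}, ContMDiffOn (𝓡 m) 𝓘(ℝ, ℝ) ∞ k U →
        ContDiffOn ℝ ∞ (k ∘ e.symm) (e.target ∩ e.symm ⁻¹' U) := fun hk =>
      contMDiffOn_iff_contDiffOn.1 (hk.comp
        ((contMDiffOn_extChartAt_symm p).mono Set.inter_subset_left) fun y hy => hy.2)
    have hps : p ∈ e.source := mem_extChartAt_source p
    have hpW : e p ∈ e.target ∩ e.symm ⁻¹' U :=
      ⟨e.map_source hps, by rw [Set.mem_preimage, e.left_inv hps]; exact hp⟩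
    obtain ⟨V, hV, hpV, hVW, h, hh, hfh⟩ := exists_eq_mul_of_fderiv_ne_zero hW hpW (hc hf) (hc hφ)
      (by rw [Function.comp_apply, e.left_inv hps, hp0]) hd' (fun y hy hy0 => h0 _ hy.2 hy0)
    have hes : IsOpen e.source := isOpen_extChartAt_source p
    refine ⟨e.source ∩ e ⁻¹' V, (continuousOn_extChartAt p).isOpen_inter_preimage hes hV,
      ⟨hps, hpV⟩, fun x hx => ?_, h ∘ e, ?_, fun x hx => ?_⟩
    · have := (hVW hx.2).2
      rwa [Set.mem_preimage, e.left_inv hx.1] at this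
    · refine (contMDiffOn_iff_contDiffOn.2 hh).comp
        ((contMDiffOn_extChartAt (x := p)).mono ?_) fun x hx => hx.2
      rw [← extChartAt_source (𝓡 m)]
      exact Set.inter_subset_left
    · have := hfh (e x) hx.2
      simpa [e.left_inv hx.1] using! this
  · refine ⟨U ∩ φ ⁻¹' {0}ᶜ, hφ.continuousOn.isOpen_inter_preimage hU isOpen_compl_singleton,
      ⟨hp, hp0⟩, Set.inter_subset_left, fun x => f x / φ x, ?_, fun x hx => ?_⟩
    · exact (hf.mono Set.inter_subset_left).div₀ (hφ.mono Set.inter_subset_left) fun x hx => hx.2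
    · have : φ x ≠ 0 := hx.2
      field_simp

/-! ### Smoothness -/

section Smoothness

variable {U : Set M} {A B C : ∀ p : M, TangentSpace (𝓡 m) p} {f : M → ℝ} {q : M}

theorem SmoothFieldOn.contMDiffAt (hA : SmoothFieldOn U A) (hU : IsOpen U) (hq : q ∈ U) :
    ContMDiffAt (𝓡 m) ((𝓡 m).prod 𝓘(ℝ, EuclideanSpace ℝ (Fin m))) ∞
      (fun p : M => TotalSpace.mk' (EuclideanSpace ℝ (Fin m)) p (A p)) q :=
  ContMDiffOn.contMDiffAt hA (hU.mem_nhds hq)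

theorem SmoothFieldOn.diffFieldAt (hA : SmoothFieldOn U A) (hU : IsOpen U) (hq : q ∈ U) :
    DiffFieldAt A q :=
  (hA.contMDiffAt hU hq).mdifferentiableAt (by simp)

theorem SmoothField.smoothFieldOn (hA : SmoothField A) : SmoothFieldOn U A :=
  ContMDiff.contMDiffOn hA

theorem SmoothFieldOn.mono {V : Set M} (hA : SmoothFieldOn U A) (h : V ⊆ U) : SmoothFieldOn V A :=
  ContMDiffOn.mono hA h

theorem SmoothFieldOn.add (hA : SmoothFieldOn U A) (hB : SmoothFieldOn U B) :
    SmoothFieldOn U (A + B) :=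
  ContMDiffOn.add_section hA hB

theorem SmoothFieldOn.sub (hA : SmoothFieldOn U A) (hB : SmoothFieldOn U B) :
    SmoothFieldOn U (A - B) :=
  ContMDiffOn.sub_section hA hB

theorem SmoothFieldOn.smul (hf : ContMDiffOn (𝓡 m) 𝓘(ℝ, ℝ) ∞ f U) (hA : SmoothFieldOn U A) :
    SmoothFieldOn U (f • A) :=
  ContMDiffOn.smul_section hf hA

theorem DiffFieldAt.add (hA : DiffFieldAt A q) (hB : DiffFieldAt B q) : DiffFieldAt (A + B) q :=
  mdifferentiableAt_add_section hA hB

theorem DiffFieldAt.smul (hf : MDifferentiableAt (𝓡 m) 𝓘(ℝ, ℝ) f q) (hA : DiffFieldAt A q) :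
    DiffFieldAt (f • A) q :=
  MDifferentiableAt.smul_section hf hA

theorem diffFieldAt_extend (a : TangentSpace (𝓡 m) q) :
    DiffFieldAt (FiberBundle.extend (EuclideanSpace ℝ (Fin m)) a) q :=
  FiberBundle.mdifferentiableAt_extend (𝓡 m) (EuclideanSpace ℝ (Fin m)) a

theorem mdifferentiableAt_of_contMDiffOn (hf : ContMDiffOn (𝓡 m) 𝓘(ℝ, ℝ) ∞ f U)
    (hU : IsOpen U) (hq : q ∈ U) : MDifferentiableAt (𝓡 m) 𝓘(ℝ, ℝ) f q :=
  (hf.contMDiffAt (hU.mem_nhds hq)).mdifferentiableAt (by simp)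

variable (g : SymTensor m M)

theorem SmoothFieldOn.pair (hA : SmoothFieldOn U A) (hB : SmoothFieldOn U B) :
    ContMDiffOn (𝓡 m) 𝓘(ℝ, ℝ) ∞ (pair g A B) U := by
  have h : ContMDiffOn (𝓡 m) ((𝓡 m).prod 𝓘(ℝ, ℝ)) ∞
      (fun p : M => TotalSpace.mk' ℝ (E := Bundle.Trivial M ℝ) p (g.toFun p (A p) (B p))) U :=
    ContMDiffOn.clm_bundle_apply₂ (F₁ := EuclideanSpace ℝ (Fin m))
      (F₂ := EuclideanSpace ℝ (Fin m)) g.smooth.contMDiffOn hA hB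
  intro q hq
  have := h q hq
  rw [contMDiffWithinAt_totalSpace] at this
  exact this.2

theorem DiffFieldAt.pair (hA : DiffFieldAt A q) (hB : DiffFieldAt B q) :
    MDifferentiableAt (𝓡 m) 𝓘(ℝ, ℝ) (pair g A B) q := by
  have h : MDifferentiableAt (𝓡 m) ((𝓡 m).prod 𝓘(ℝ, ℝ))
      (fun p : M => TotalSpace.mk' ℝ (E := Bundle.Trivial M ℝ) p (g.toFun p (A p) (B p))) q :=
    MDifferentiableAt.clm_bundle_apply₂ (F₁ := EuclideanSpace ℝ (Fin m))
      (F₂ := EuclideanSpace ℝ (Fin m)) (g.smooth.mdifferentiableAt (by simp)) hA hB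
  rw [mdifferentiableAt_totalSpace] at h
  exact h.2

theorem SmoothFieldOn.mvfderiv (hU : IsOpen U) (hf : ContMDiffOn (𝓡 m) 𝓘(ℝ, ℝ) ∞ f U)
    (hA : SmoothFieldOn U A) :
    ContMDiffOn (𝓡 m) 𝓘(ℝ, ℝ) ∞ (fun p => mvfderiv (𝓡 m) f p (A p)) U := by
  have h1 := hf.contMDiffOn_tangentMapWithin (m := ∞) (by simp) hU.uniqueMDiffOn
  have h2 := h1.comp hA (fun q hq => hq)
  intro q hq
  have h3 := h2 q hq
  rw [contMDiffWithinAt_totalSpace] at h3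
  refine h3.2.congr (fun x hx => ?_) ?_
  · simp [tangentMapWithin, mfderivWithin_of_isOpen hU hx, _root_.mvfderiv]
    rfl
  · simp [tangentMapWithin, mfderivWithin_of_isOpen hU hq, _root_.mvfderiv]
    rfl

theorem SmoothFieldOn.mlieBracket (hU : IsOpen U) (hA : SmoothFieldOn U A)
    (hB : SmoothFieldOn U B) : SmoothFieldOn U (VectorField.mlieBracket (𝓡 m) A B) := by
  intro q hq
  have : IsManifold (𝓡 m) (((⊤ : ℕ∞) : WithTop ℕ∞) + 1) M := by simpa using ‹IsManifold (𝓡 m) ∞ M›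
  have : IsManifold (𝓡 m) (minSmoothness ℝ 2) M := IsManifold.of_le (n := ∞) (by
    rw [minSmoothness_of_isRCLikeNormedField]; exact ENat.LEInfty.out)
  exact (ContMDiffAt.mlieBracket_vectorField (m := ⊤) (n := ⊤) (hA.contMDiffAt hU hq)
    (hB.contMDiffAt hU hq) (by simp)).contMDiffWithinAt

theorem SmoothFieldOn.dualConn (hU : IsOpen U) (hA : SmoothFieldOn U A)
    (hB : SmoothFieldOn U B) (hC : SmoothFieldOn U C) :
    ContMDiffOn (𝓡 m) 𝓘(ℝ, ℝ) ∞ (dualConn g A B C) U :=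
  contMDiffOn_const.mul ((((((SmoothFieldOn.mvfderiv hU (hB.pair g hC) hA).add
    (SmoothFieldOn.mvfderiv hU (hC.pair g hA) hB)).sub
    (SmoothFieldOn.mvfderiv hU (hA.pair g hB) hC)).add
    ((hA.mlieBracket hU hB).pair g hC)).sub ((hB.mlieBracket hU hC).pair g hA)).add
    ((hC.mlieBracket hU hA).pair g hB))

end Smoothness
end
-- Tensoriality of the dual connection and bilinearity of `II`
section DualConnection

variable {m : ℕ} {M : Type*} [TopologicalSpace M]
  [ChartedSpace (EuclideanSpace ℝ (Fin m)) M] [IsManifold (𝓡 m) ∞ M]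
  {A B C D : ∀ p : M, TangentSpace (𝓡 m) p} {f : M → ℝ} {q : M} (g : SymTensor m M)

theorem pair_comm (A B : ∀ p : M, TangentSpace (𝓡 m) p) : pair g A B = pair g B A :=
  funext fun p => g.symm p _ _

theorem pair_add_left (A B C : ∀ p : M, TangentSpace (𝓡 m) p) :
    pair g (A + B) C = pair g A C + pair g B C :=
  funext fun p => by simp [pair]

theorem pair_smul_left (f : M → ℝ) (A B : ∀ p : M, TangentSpace (𝓡 m) p) :
    pair g (f • A) B = f * pair g A B :=
  funext fun p => by simp [pair]

theorem pair_add_right (A B C : ∀ p : M, TangentSpace (𝓡 m) p) :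
    pair g A (B + C) = pair g A B + pair g A C :=
  funext fun p => by simp [pair]

theorem pair_smul_right (f : M → ℝ) (A B : ∀ p : M, TangentSpace (𝓡 m) p) :
    pair g A (f • B) = f * pair g A B :=
  funext fun p => by simp [pair]

/-- The dual connection is compatible with the metric. -/
theorem dualConn_add_swap (A B C : ∀ p : M, TangentSpace (𝓡 m) p) (q : M) :
    dualConn g A B C q + dualConn g A C B q = mvfderiv (𝓡 m) (pair g B C) q (A q) := by
  simp only [dualConn]
  rw [pair_comm g C B, pair_comm g C A, pair_comm g B A,
    VectorField.mlieBracket_swap_apply (V := C) (W := A),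
    VectorField.mlieBracket_swap_apply (V := C) (W := B),
    VectorField.mlieBracket_swap_apply (V := B) (W := A)]
  simp only [map_neg, neg_apply]
  ring

/-- The dual connection is torsion-free. -/
theorem dualConn_sub_swap (A B C : ∀ p : M, TangentSpace (𝓡 m) p) (q : M) :
    dualConn g A B C q - dualConn g B A C q =
      g.toFun q (VectorField.mlieBracket (𝓡 m) A B q) (C q) := by
  simp only [dualConn]
  rw [pair_comm g C B, pair_comm g C A, pair_comm g B A,
    VectorField.mlieBracket_swap_apply (V := C) (W := A),
    VectorField.mlieBracket_swap_apply (V := C) (W := B),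
    VectorField.mlieBracket_swap_apply (V := B) (W := A)]
  simp only [map_neg, neg_apply]
  ring

/-- For a coefficient `f` on `C`, the derivatives of `f` produced by the two pairings cancel those
produced by the two brackets. -/
theorem tensorialAt_dualConn_right (hA : DiffFieldAt A q) (hB : DiffFieldAt B q) :
    TensorialAt (𝓡 m) (EuclideanSpace ℝ (Fin m)) (fun C => dualConn g A B C q) q where
  smul {f C} hf hC := by
    have hC' : DiffFieldAt C q := hC
    simp only [dualConn]
    rw [pair_smul_right, pair_smul_left, mvfderiv_mul hf (hB.pair g hC'),
      mvfderiv_mul hf (hC'.pair g hA), VectorField.mlieBracket_smul_right hf hC,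
      VectorField.mlieBracket_smul_left hf hC, pair_comm g B C, pair_comm g C A]
    simp [pair, g.symm q (C q)]
    ring
  add {C C'} hC hC' := by
    have hC1 : DiffFieldAt C q := hC
    have hC2 : DiffFieldAt C' q := hC'
    simp only [dualConn]
    rw [pair_add_right, pair_add_left, mvfderiv_add (hB.pair g hC1) (hB.pair g hC2),
      mvfderiv_add (hC1.pair g hA) (hC2.pair g hA), VectorField.mlieBracket_add_right hC hC',
      VectorField.mlieBracket_add_left hC hC']
    simp
    ring

theorem tensorialAt_dualConn_left (hB : DiffFieldAt B q) (hC : DiffFieldAt C q) :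
    TensorialAt (𝓡 m) (EuclideanSpace ℝ (Fin m)) (fun A => dualConn g A B C q) q where
  smul {f A} hf hA := by
    have hA' : DiffFieldAt A q := hA
    simp only [dualConn]
    rw [pair_smul_right, pair_smul_left, mvfderiv_mul hf (hA'.pair g hB),
      mvfderiv_mul hf (hC.pair g hA'), VectorField.mlieBracket_smul_right hf hA,
      VectorField.mlieBracket_smul_left hf hA]
    simp [pair, g.symm q (A q)]
    ring
  add {A A'} hA hA' := by
    have hA1 : DiffFieldAt A q := hA
    have hA2 : DiffFieldAt A' q := hA'
    simp only [dualConn]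
    rw [pair_add_right, pair_add_left, mvfderiv_add (hC.pair g hA1) (hC.pair g hA2),
      mvfderiv_add (hA1.pair g hB) (hA2.pair g hB), VectorField.mlieBracket_add_right hA hA',
      VectorField.mlieBracket_add_left hA hA']
    simp
    ring

theorem dualConn_middle_eq (A B C : ∀ p : M, TangentSpace (𝓡 m) p) (q : M) :
    dualConn g A B C q = mvfderiv (𝓡 m) (pair g B C) q (A q) - dualConn g A C B q := by
  rw [← dualConn_add_swap]; ring

theorem dualConn_add_middle (hA : DiffFieldAt A q) (hB : DiffFieldAt B q) (hC : DiffFieldAt C q)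
    (hD : DiffFieldAt D q) :
    dualConn g A (B + C) D q = dualConn g A B D q + dualConn g A C D q := by
  rw [dualConn_middle_eq, dualConn_middle_eq g A B, dualConn_middle_eq g A C, pair_add_left,
    mvfderiv_add (hB.pair g hD) (hC.pair g hD),
    (tensorialAt_dualConn_right g hA hD).add hB hC]
  simp
  ring

theorem dualConn_smul_middle (hA : DiffFieldAt A q) (hB : DiffFieldAt B q)
    (hf : MDifferentiableAt (𝓡 m) 𝓘(ℝ, ℝ) f q) (hD : DiffFieldAt D q) :
    dualConn g A (f • B) D q =
      mvfderiv (𝓡 m) f q (A q) * g.toFun q (B q) (D q) + f q * dualConn g A B D q := by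
  rw [dualConn_middle_eq, dualConn_middle_eq g A B, pair_smul_left,
    mvfderiv_mul hf (hB.pair g hD), (tensorialAt_dualConn_right g hA hD).smul hf hB]
  simp [pair]
  ring

/-- In the middle slot the Leibniz term is `(A f) ⟨B, C⟩`, and it drops out because `C q` is
radical. This makes `II` independent of the extensions. -/
theorem tensorialAt_dualConn_middle (hA : DiffFieldAt A q) (hC : DiffFieldAt C q)
    (hr : C q ∈ radical g q) :
    TensorialAt (𝓡 m) (EuclideanSpace ℝ (Fin m)) (fun B => dualConn g A B C q) q where
  smul {f B} hf hB := by
    rw [dualConn_smul_middle g hA hB hf hC, g.symm, hr (B q)]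
    simp
  add hB hB' := dualConn_add_middle g hA hB hB' hC

/-- `II_r(a,b)` may be computed with any differentiable extensions. -/
theorem II_eq_dualConn (hA : DiffFieldAt A q) (hB : DiffFieldAt B q) (hC : DiffFieldAt C q)
    (hr : C q ∈ radical g q) : II g (C q) (A q) (B q) = dualConn g A B C q := by
  have hA' := diffFieldAt_extend (A q)
  have hB' := diffFieldAt_extend (B q)
  have hC' := diffFieldAt_extend (C q)
  have hr' : FiberBundle.extend (EuclideanSpace ℝ (Fin m)) (C q) q ∈ radical g q := by simpa
  rw [II, (tensorialAt_dualConn_left g hB' hC').pointwise hA' hA (by simp),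
    (tensorialAt_dualConn_middle g hA hC' hr').pointwise hB' hB (by simp),
    (tensorialAt_dualConn_right g hA hB).pointwise hC' hC (by simp)]

variable {r : TangentSpace (𝓡 m) q}

theorem II_add_left (hr : r ∈ radical g q) (a a' b : TangentSpace (𝓡 m) q) :
    II g r (a + a') b = II g r a b + II g r a' b := by
  have h := II_eq_dualConn g ((diffFieldAt_extend a).add (diffFieldAt_extend a'))
    (diffFieldAt_extend b) (diffFieldAt_extend r) (by simpa)
  simp only [Pi.add_apply, FiberBundle.extend_apply_self] at h
  rw [h, (tensorialAt_dualConn_left g (diffFieldAt_extend b) (diffFieldAt_extend r)).add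
    (diffFieldAt_extend a) (diffFieldAt_extend a')]
  rfl

theorem II_smul_left (hr : r ∈ radical g q) (t : ℝ) (a b : TangentSpace (𝓡 m) q) :
    II g r (t • a) b = t * II g r a b := by
  have hf : MDifferentiableAt (𝓡 m) 𝓘(ℝ, ℝ) (fun _ : M => t) q := mdifferentiableAt_const
  have h := II_eq_dualConn g (DiffFieldAt.smul hf (diffFieldAt_extend a))
    (diffFieldAt_extend b) (diffFieldAt_extend r) (by simpa)
  simp only [Pi.smul_apply', FiberBundle.extend_apply_self] at h
  rw [h, (tensorialAt_dualConn_left g (diffFieldAt_extend b) (diffFieldAt_extend r)).smul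
    hf (diffFieldAt_extend a)]
  rfl

/-- The antisymmetric part is the torsion term `⟨[A,B], r⟩`, which is zero for radical `r`. -/
theorem II_comm (hr : r ∈ radical g q) (a b : TangentSpace (𝓡 m) q) :
    II g r a b = II g r b a := by
  have h := dualConn_sub_swap g (FiberBundle.extend (EuclideanSpace ℝ (Fin m)) a)
    (FiberBundle.extend (EuclideanSpace ℝ (Fin m)) b)
    (FiberBundle.extend (EuclideanSpace ℝ (Fin m)) r) q
  rw [FiberBundle.extend_apply_self, g.symm, hr] at h
  exact sub_eq_zero.1 h

theorem II_add_right (hr : r ∈ radical g q) (a b b' : TangentSpace (𝓡 m) q) :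
    II g r a (b + b') = II g r a b + II g r a b' := by
  rw [II_comm g hr, II_add_left g hr, II_comm g hr b, II_comm g hr b']

theorem II_smul_right (hr : r ∈ radical g q) (t : ℝ) (a b : TangentSpace (𝓡 m) q) :
    II g r a (t • b) = t * II g r a b := by
  rw [II_comm g hr, II_smul_left g hr, II_comm g hr]

theorem II_smul_radical (t : ℝ) (r a b : TangentSpace (𝓡 m) q) :
    II g (t • r) a b = t * II g r a b := by
  have hf : MDifferentiableAt (𝓡 m) 𝓘(ℝ, ℝ) (fun _ : M => t) q := mdifferentiableAt_const
  have hT := tensorialAt_dualConn_right g (diffFieldAt_extend a) (diffFieldAt_extend b)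
  have h1 := hT.smul hf (diffFieldAt_extend r)
  rw [II, II, ← smul_eq_mul, ← h1]
  exact hT.pointwise (diffFieldAt_extend _) (DiffFieldAt.smul hf (diffFieldAt_extend r)) (by simp)

end DualConnection

noncomputable section

variable {m : ℕ} {M : Type*} [TopologicalSpace M]
  [ChartedSpace (EuclideanSpace ℝ (Fin m)) M] [IsManifold (𝓡 m) ∞ M]

/-! ### Coordinate frames and Gram matrices -/

variable (m) in
/-- The domain of the coordinate frame at `p`. -/
def frameSet (p : M) : Set M :=
  (trivializationAt (EuclideanSpace ℝ (Fin m)) (TangentSpace (𝓡 m)) p).baseSet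

/-- The coordinate frame at `p`. -/
def frame (p : M) (i : Fin m) : ∀ q : M, TangentSpace (𝓡 m) q :=
  (trivializationAt (EuclideanSpace ℝ (Fin m)) (TangentSpace (𝓡 m)) p).localFrame
    (EuclideanSpace.basisFun (Fin m) ℝ).toBasis i

/-- The coefficients of a tangent vector in the coordinate frame at `p`. -/
def frameCoeff (p : M) (i : Fin m) (q : M) : TangentSpace (𝓡 m) q →ₗ[ℝ] ℝ :=
  (trivializationAt (EuclideanSpace ℝ (Fin m)) (TangentSpace (𝓡 m)) p).localFrameCoeff (𝓡 m)
    (EuclideanSpace.basisFun (Fin m) ℝ).toBasis i q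

theorem isOpen_frameSet (p : M) : IsOpen (frameSet m p) := Trivialization.open_baseSet _

theorem mem_frameSet (p : M) : p ∈ frameSet m p :=
  FiberBundle.mem_baseSet_trivializationAt' p

theorem smoothFieldOn_frame (p : M) (i : Fin m) : SmoothFieldOn (frameSet m p) (frame p i) :=
  Trivialization.contMDiffOn_localFrame_baseSet ∞ _ _ i

variable {p q : M} {U : Set M} {A B C D : ∀ p : M, TangentSpace (𝓡 m) p} {f : M → ℝ}

theorem diffFieldAt_frame (hq : q ∈ frameSet m p) (i : Fin m) : DiffFieldAt (frame p i) q :=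
  (smoothFieldOn_frame p i).diffFieldAt (isOpen_frameSet p) hq

theorem sum_frameCoeff (hq : q ∈ frameSet m p) (v : TangentSpace (𝓡 m) q) :
    ∑ i, frameCoeff p i q v • frame p i q = v := by
  have := Trivialization.eq_sum_localFrameCoeff_smul (I := 𝓡 m)
    (s := FiberBundle.extend (EuclideanSpace ℝ (Fin m)) v)
    (b := (EuclideanSpace.basisFun (Fin m) ℝ).toBasis) hq
  rw [FiberBundle.extend_apply_self] at this
  exact this.symm

theorem frameCoeff_sum (hq : q ∈ frameSet m p) (c : Fin m → ℝ) (k : Fin m) :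
    frameCoeff p k q (∑ i, c i • frame p i q) = c k := by
  have h := Trivialization.localFrameCoeff_apply_of_mem_baseSet (I := 𝓡 m)
    (trivializationAt (EuclideanSpace ℝ (Fin m)) (TangentSpace (𝓡 m)) p)
    (EuclideanSpace.basisFun (Fin m) ℝ).toBasis hq
    (FiberBundle.extend (EuclideanSpace ℝ (Fin m)) (∑ i, c i • frame p i q)) k
  rw [FiberBundle.extend_apply_self] at h
  rw [frameCoeff, h]
  have h2 : ∀ i, frame p i q = (trivializationAt (EuclideanSpace ℝ (Fin m))
      (TangentSpace (𝓡 m)) p).basisAt (EuclideanSpace.basisFun (Fin m) ℝ).toBasis hq i :=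
    fun i => Trivialization.localFrame_apply_of_mem_baseSet _ _ hq
  simp only [h2]
  rw [Module.Basis.repr_sum_self]

theorem SmoothFieldOn.frameCoeff (hU : IsOpen U) (hA : SmoothFieldOn U A) (i : Fin m) :
    ContMDiffOn (𝓡 m) 𝓘(ℝ, ℝ) ∞ (fun q => frameCoeff p i q (A q)) (U ∩ frameSet m p) :=
  contMDiffOn_localFrameCoeff (EuclideanSpace.basisFun (Fin m) ℝ).toBasis
    (hU.inter (isOpen_frameSet p)) Set.inter_subset_right (hA.mono Set.inter_subset_left) i

theorem smoothFieldOn_sum_frame {c : Fin m → M → ℝ} (hU : U ⊆ frameSet m p)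
    (hc : ∀ i, ContMDiffOn (𝓡 m) 𝓘(ℝ, ℝ) ∞ (c i) U) :
    SmoothFieldOn U (fun q => ∑ i, c i q • frame p i q) :=
  ContMDiffOn.sum_section fun i _ => (hc i).smul_section ((smoothFieldOn_frame p i).mono hU)

theorem diffFieldAt_sum_frame (c : Fin m → ℝ) (hq : q ∈ frameSet m p) :
    DiffFieldAt (fun q => ∑ i, c i • frame p i q) q :=
  (smoothFieldOn_sum_frame (c := fun i _ => c i) subset_rfl
    fun i => contMDiffOn_const).diffFieldAt (isOpen_frameSet p) hq

variable (g : SymTensor m M)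

/-- The Gram matrix of the coordinate frame at `p`. -/
def gram (p q : M) : Matrix (Fin m) (Fin m) ℝ :=
  Matrix.of fun i j => g.toFun q (frame p i q) (frame p j q)

theorem gram_isSymm (p q : M) : (gram g p q).IsSymm :=
  Matrix.IsSymm.ext fun _ _ => g.symm q _ _

theorem contMDiffOn_gram (p : M) (i j : Fin m) :
    ContMDiffOn (𝓡 m) 𝓘(ℝ, ℝ) ∞ (fun q => gram g p q i j) (frameSet m p) :=
  (smoothFieldOn_frame p i).pair g (smoothFieldOn_frame p j)

theorem contMDiffOn_det {G : M → Matrix (Fin m) (Fin m) ℝ}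
    (hG : ∀ i j, ContMDiffOn (𝓡 m) 𝓘(ℝ, ℝ) ∞ (fun q => G q i j) U) :
    ContMDiffOn (𝓡 m) 𝓘(ℝ, ℝ) ∞ (fun q => (G q).det) U := by
  simp only [Matrix.det_apply, Units.smul_def, zsmul_eq_mul]
  exact contMDiffOn_finsetSum fun σ _ => contMDiffOn_const.mul
    (contMDiffOn_finsetProd fun _ _ => hG _ _)

theorem contMDiffOn_adjugate {G : M → Matrix (Fin m) (Fin m) ℝ}
    (hG : ∀ i j, ContMDiffOn (𝓡 m) 𝓘(ℝ, ℝ) ∞ (fun q => G q i j) U) (i j : Fin m) :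
    ContMDiffOn (𝓡 m) 𝓘(ℝ, ℝ) ∞ (fun q => (G q).adjugate i j) U := by
  simp only [Matrix.adjugate_apply]
  refine contMDiffOn_det fun a b => ?_
  by_cases h : a = j
  · subst h
    simp only [Matrix.updateRow_self]
    exact contMDiffOn_const
  · simp only [Matrix.updateRow_ne h]
    exact hG a b

theorem gram_mulVec (hq : q ∈ frameSet m p) (v : TangentSpace (𝓡 m) q) (i : Fin m) :
    (gram g p q).mulVec (fun j => frameCoeff p j q v) i = g.toFun q v (frame p i q) := by
  conv_rhs => rw [g.symm, ← sum_frameCoeff hq v, map_sum]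
  simp [Matrix.mulVec, dotProduct, gram, mul_comm]

theorem mem_radical_iff (hq : q ∈ frameSet m p) (v : TangentSpace (𝓡 m) q) :
    v ∈ radical g q ↔ ∀ i, g.toFun q v (frame p i q) = 0 := by
  refine ⟨fun h i => h _, fun h w => ?_⟩
  rw [← sum_frameCoeff hq w, map_sum]
  exact Finset.sum_eq_zero fun i _ => by rw [map_smul, h i, smul_zero]

theorem mem_singularSet_iff (hq : q ∈ frameSet m p) :
    q ∈ singularSet g ↔ (gram g p q).det = 0 := by
  rw [← Matrix.exists_mulVec_eq_zero_iff]
  constructor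
  · intro h
    obtain ⟨v, hv, hv0⟩ := (Submodule.ne_bot_iff _).1 h
    refine ⟨fun j => frameCoeff p j q v, fun h0 => hv0 ?_, funext fun i => ?_⟩
    · rw [← sum_frameCoeff hq v]
      exact Finset.sum_eq_zero fun i _ => by rw [congrFun h0 i]; simp
    · rw [gram_mulVec g hq]; exact hv _
  · rintro ⟨c, hc, h⟩
    refine (Submodule.ne_bot_iff _).2 ⟨∑ i, c i • frame p i q, ?_, fun h0 => hc ?_⟩
    · rw [mem_radical_iff g hq]
      intro i
      rw [← gram_mulVec g hq]
      simp only [frameCoeff_sum hq]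
      exact congrFun h i
    · ext k
      rw [← frameCoeff_sum hq c k, h0, map_zero]; rfl

theorem isClosed_singularSet : IsClosed (singularSet g) := by
  rw [← isOpen_compl_iff, isOpen_iff_mem_nhds]
  intro q hq
  have hd := contMDiffOn_det (contMDiffOn_gram g q)
  have ho := hd.continuousOn.isOpen_inter_preimage (isOpen_frameSet q)
    (isOpen_compl_singleton (x := (0 : ℝ)))
  refine Filter.mem_of_superset (ho.mem_nhds ⟨mem_frameSet q, ?_⟩) ?_
  · exact fun h => hq ((mem_singularSet_iff g (mem_frameSet q)).2 h)
  · exact fun x hx h => hx.2 ((mem_singularSet_iff g hx.1).1 h)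

/-- Only the value `C q` matters in the last slot, so the frame coefficients can be frozen at `q`.
-/
theorem dualConn_eq_sum (hq : q ∈ frameSet m p) (hA : DiffFieldAt A q) (hB : DiffFieldAt B q)
    (hC : DiffFieldAt C q) :
    dualConn g A B C q = ∑ i, frameCoeff p i q (C q) * dualConn g A B (frame p i) q := by
  have hT := tensorialAt_dualConn_right g hA hB
  have hc : ∀ i, MDifferentiableAt (𝓡 m) 𝓘(ℝ, ℝ) (fun _ : M => frameCoeff p i q (C q)) q :=
    fun i => mdifferentiableAt_const
  have hE := fun i => diffFieldAt_frame (m := m) hq i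
  calc dualConn g A B C q
      = dualConn g A B (fun q' => ∑ i, ((fun _ : M => frameCoeff p i q (C q)) • frame p i) q') q :=
        hT.pointwise hC (diffFieldAt_sum_frame _ hq) (sum_frameCoeff hq (C q)).symm
    _ = _ := by
        rw [hT.sum _ fun i _ => DiffFieldAt.smul (hc i) (hE i)]
        exact Finset.sum_congr rfl fun i _ => hT.smul (hc i) (hE i)

/-! ### The Levi-Civita connection off the singular set -/

theorem eq_of_forall_diffFieldAt (hq : q ∉ singularSet g) {v w : TangentSpace (𝓡 m) q}
    (h : ∀ C : ∀ q : M, TangentSpace (𝓡 m) q, DiffFieldAt C q →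
      g.toFun q v (C q) = g.toFun q w (C q)) : v = w := by
  have h0 : radical g q = ⊥ := not_not.1 hq
  have : v - w ∈ radical g q := fun u => by
    have := h _ (diffFieldAt_extend u)
    rw [FiberBundle.extend_apply_self] at this
    simp [this]
  rw [h0, Submodule.mem_bot] at this
  exact sub_eq_zero.1 this

/-- The Levi-Civita connection in the coordinate frame at `p`. -/
def frameConn (p : M) (A B : ∀ p : M, TangentSpace (𝓡 m) p) (q : M) : TangentSpace (𝓡 m) q :=
  ∑ i, ((gram g p q).det⁻¹ * ∑ j, (gram g p q).adjugate i j * dualConn g A B (frame p j) q) •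
    frame p i q

/-- Off `Σ` the inverse Gram matrix is `(det G)⁻¹ adj G`. This also supplies the existence that the
choice in `leviCivita` depends on. -/
theorem frameConn_spec (hq : q ∈ frameSet m p) (hs : q ∉ singularSet g) (hA : DiffFieldAt A q)
    (hB : DiffFieldAt B q) (hC : DiffFieldAt C q) :
    g.toFun q (frameConn g p A B q) (C q) = dualConn g A B C q := by
  have hd : (gram g p q).det ≠ 0 := fun h => hs ((mem_singularSet_iff g hq).2 h)
  have hk : ∀ k, g.toFun q (frameConn g p A B q) (frame p k q) = dualConn g A B (frame p k) q := by
    intro k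
    rw [← gram_mulVec g hq]
    simp only [frameConn, frameCoeff_sum hq]
    have h1 : (fun j => (gram g p q).det⁻¹ * ∑ l, (gram g p q).adjugate j l *
        dualConn g A B (frame p l) q) = (gram g p q).det⁻¹ •
          (gram g p q).adjugate.mulVec fun l => dualConn g A B (frame p l) q := rfl
    rw [h1, Matrix.mulVec_smul, Matrix.mulVec_mulVec, Matrix.mul_adjugate, Matrix.smul_mulVec,
      Matrix.one_mulVec, smul_smul, inv_mul_cancel₀ hd, one_smul]
  rw [dualConn_eq_sum g hq hA hB hC]
  conv_lhs => rw [← sum_frameCoeff hq (C q), map_sum]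
  exact Finset.sum_congr rfl fun i _ => by rw [map_smul, hk i, smul_eq_mul]

theorem leviCivita_spec (hs : q ∉ singularSet g) (hA : DiffFieldAt A q) (hB : DiffFieldAt B q)
    (hC : DiffFieldAt C q) : g.toFun q (leviCivita g A B q) (C q) = dualConn g A B C q :=
  Classical.epsilon_spec (p := fun v : TangentSpace (𝓡 m) q =>
    ∀ C : ∀ q : M, TangentSpace (𝓡 m) q, DiffFieldAt C q →
      g.toFun q v (C q) = dualConn g A B C q)
    ⟨_, fun _ hC => frameConn_spec g (mem_frameSet q) hs hA hB hC⟩ C hC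

theorem leviCivita_eq_frameConn (hq : q ∈ frameSet m p) (hs : q ∉ singularSet g)
    (hA : DiffFieldAt A q) (hB : DiffFieldAt B q) :
    leviCivita g A B q = frameConn g p A B q :=
  eq_of_forall_diffFieldAt g hs fun _ hC => by
    rw [leviCivita_spec g hs hA hB hC, frameConn_spec g hq hs hA hB hC]

theorem SmoothFieldOn.leviCivita (hU : IsOpen U) (hA : SmoothFieldOn U A)
    (hB : SmoothFieldOn U B) : SmoothFieldOn (U \ singularSet g) (leviCivita g A B) := by
  intro q hq
  have hV : IsOpen (U \ singularSet g) := hU.sdiff (isClosed_singularSet g)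
  have hW := hV.inter (isOpen_frameSet (m := m) q)
  have hqW : q ∈ (U \ singularSet g) ∩ frameSet m q := ⟨hq, mem_frameSet q⟩
  have hG : ∀ i j, ContMDiffOn (𝓡 m) 𝓘(ℝ, ℝ) ∞ (fun x => gram g q x i j)
      ((U \ singularSet g) ∩ frameSet m q) := fun i j =>
    (contMDiffOn_gram g q i j).mono Set.inter_subset_right
  have h1 : SmoothFieldOn ((U \ singularSet g) ∩ frameSet m q) (frameConn g q A B) := by
    refine smoothFieldOn_sum_frame Set.inter_subset_right fun i => ?_
    refine ContMDiffOn.mul ((contMDiffOn_det hG).inv₀ fun x hx h =>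
      hx.1.2 ((mem_singularSet_iff g hx.2).2 h)) (contMDiffOn_finsetSum fun j _ => ?_)
    exact (contMDiffOn_adjugate hG i j).mul (SmoothFieldOn.dualConn g hW
      (hA.mono fun x hx => hx.1.1) (hB.mono fun x hx => hx.1.1)
      ((smoothFieldOn_frame q j).mono fun x hx => hx.2))
  refine ((h1.contMDiffAt hW hqW).congr_of_eventuallyEq ?_).contMDiffWithinAt
  filter_upwards [hW.mem_nhds hqW] with x hx
  rw [← leviCivita_eq_frameConn g hx.2 hx.1.2 (hA.diffFieldAt hU hx.1.1) (hB.diffFieldAt hU hx.1.1)]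

theorem leviCivita_add_left (hs : q ∉ singularSet g) (hA : DiffFieldAt A q)
    (hB : DiffFieldAt B q) (hC : DiffFieldAt C q) :
    leviCivita g (A + B) C q = leviCivita g A C q + leviCivita g B C q :=
  eq_of_forall_diffFieldAt g hs fun D hD => by
    rw [map_add, add_apply, leviCivita_spec g hs (hA.add hB) hC hD,
      leviCivita_spec g hs hA hC hD, leviCivita_spec g hs hB hC hD,
      (tensorialAt_dualConn_left g hC hD).add hA hB]

theorem leviCivita_smul_left (hs : q ∉ singularSet g)
    (hf : MDifferentiableAt (𝓡 m) 𝓘(ℝ, ℝ) f q) (hA : DiffFieldAt A q) (hC : DiffFieldAt C q) :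
    leviCivita g (f • A) C q = f q • leviCivita g A C q :=
  eq_of_forall_diffFieldAt g hs fun D hD => by
    rw [map_smul, smul_apply, leviCivita_spec g hs (DiffFieldAt.smul hf hA) hC hD,
      leviCivita_spec g hs hA hC hD, (tensorialAt_dualConn_left g hC hD).smul hf hA]

/-! ### Curvature -/

theorem mvfderiv_congr {f f' : M → ℝ} (h : f =ᶠ[𝓝 q] f') :
    mvfderiv (𝓡 m) f q = mvfderiv (𝓡 m) f' q := by
  ext v
  exact congrArg (fun L : EuclideanSpace ℝ (Fin m) →L[ℝ] ℝ => L v) h.mfderiv_eq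

/-- The bracket of vector fields acts on functions as a commutator. -/
theorem mvfderiv_mlieBracket (hU : IsOpen U) (hq : q ∈ U) (hA : SmoothFieldOn U A)
    (hB : SmoothFieldOn U B) (hf : ContMDiffOn (𝓡 m) 𝓘(ℝ, ℝ) ∞ f U) {X : TangentSpace (𝓡 m) q}
    (hX : X ≠ 0) :
    mvfderiv (𝓡 m) f q (VectorField.mlieBracket (𝓡 m) A B q) =
      mvfderiv (𝓡 m) (fun x => mvfderiv (𝓡 m) f x (B x)) q (A q) -
      mvfderiv (𝓡 m) (fun x => mvfderiv (𝓡 m) f x (A x)) q (B q) := by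
  set Y := FiberBundle.extend (EuclideanSpace ℝ (Fin m)) X
  obtain ⟨s, hs, hYs⟩ := FiberBundle.exists_contMDiffOn_extend (k := ∞) (𝓡 m)
    (EuclideanSpace ℝ (Fin m)) X
  obtain ⟨V, hVs, hV, hqV⟩ := mem_nhds_iff.1 hs
  have hW := hU.inter hV
  have hqW : q ∈ U ∩ V := ⟨hq, hqV⟩
  have hY : SmoothFieldOn (U ∩ V) Y := ContMDiffOn.mono hYs fun x hx => hVs hx.2
  replace hA := hA.mono (Set.inter_subset_left (t := V))
  replace hB := hB.mono (Set.inter_subset_left (t := V))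
  replace hf := hf.mono (Set.inter_subset_left (t := V))
  have h2 : minSmoothness ℝ 2 ≤ (∞ : WithTop ℕ∞) := by
    rw [minSmoothness_of_isRCLikeNormedField]; exact ENat.LEInfty.out
  have : IsManifold (𝓡 m) (minSmoothness ℝ 3) M := IsManifold.of_le (n := ∞) (by
    rw [minSmoothness_of_isRCLikeNormedField]; exact ENat.LEInfty.out)
  -- The Jacobi identity for `A, B, f • Y` minus `f` times the one for `A, B, Y` leaves the
  -- commutator defect of `f` multiplied by `Y q = X`. This is why a nonzero tangent vector is
  -- required.
  have hJ := VectorField.leibniz_identity_mlieBracket_apply (I := 𝓡 m)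
    ((hA.contMDiffAt hW hqW).of_le h2) ((hB.contMDiffAt hW hqW).of_le h2)
    (((hY.smul hf).contMDiffAt hW hqW).of_le h2)
  have hJ' := VectorField.leibniz_identity_mlieBracket_apply (I := 𝓡 m)
    ((hA.contMDiffAt hW hqW).of_le h2) ((hB.contMDiffAt hW hqW).of_le h2)
    ((hY.contMDiffAt hW hqW).of_le h2)
  have hfd : ∀ x ∈ U ∩ V, MDifferentiableAt (𝓡 m) 𝓘(ℝ, ℝ) f x := fun x hx =>
    mdifferentiableAt_of_contMDiffOn hf hW hx
  have hYd := hY.diffFieldAt hW hqW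
  have key : ∀ {S T : ∀ p : M, TangentSpace (𝓡 m) p}, SmoothFieldOn (U ∩ V) S →
      SmoothFieldOn (U ∩ V) T →
      VectorField.mlieBracket (𝓡 m) S (VectorField.mlieBracket (𝓡 m) T (f • Y)) q =
      mvfderiv (𝓡 m) (fun x => mvfderiv (𝓡 m) f x (T x)) q (S q) • Y q +
      mvfderiv (𝓡 m) f q (T q) • VectorField.mlieBracket (𝓡 m) S Y q +
      (mvfderiv (𝓡 m) f q (S q) • VectorField.mlieBracket (𝓡 m) T Y q +
      f q • VectorField.mlieBracket (𝓡 m) S (VectorField.mlieBracket (𝓡 m) T Y) q) := by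
    intro S T hS hT
    have hTf := SmoothFieldOn.mvfderiv hW hf hT
    have hTfd := mdifferentiableAt_of_contMDiffOn hTf hW hqW
    have hTY := (hT.mlieBracket hW hY).diffFieldAt hW hqW
    have he : VectorField.mlieBracket (𝓡 m) T (f • Y) =ᶠ[𝓝 q]
        (fun x => mvfderiv (𝓡 m) f x (T x)) • Y + f • VectorField.mlieBracket (𝓡 m) T Y := by
      filter_upwards [hW.mem_nhds hqW] with x hx
      rw [VectorField.mlieBracket_smul_right (hfd x hx) (hY.diffFieldAt hW hx)]
      rfl
    rw [Filter.EventuallyEq.mlieBracket_vectorField_eq (V₁ := S) (V := S) .rfl he,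
      VectorField.mlieBracket_add_right (DiffFieldAt.smul hTfd hYd)
        (DiffFieldAt.smul (hfd q hqW) hTY),
      VectorField.mlieBracket_smul_right hTfd hYd,
      VectorField.mlieBracket_smul_right (hfd q hqW) hTY]
  rw [key hA hB, key hB hA, VectorField.mlieBracket_smul_right (hfd q hqW) hYd, hJ'] at hJ
  have hYq : Y q = X := FiberBundle.extend_apply_self _ _
  rw [hYq] at hJ
  have h0 : (mvfderiv (𝓡 m) f q (VectorField.mlieBracket (𝓡 m) A B q) -
      (mvfderiv (𝓡 m) (fun x => mvfderiv (𝓡 m) f x (B x)) q (A q) -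
      mvfderiv (𝓡 m) (fun x => mvfderiv (𝓡 m) f x (A x)) q (B q))) • X = 0 := by
    rw [sub_smul, sub_smul]
    rw [smul_add] at hJ
    refine Eq.trans ?_ (neg_eq_zero.2 (sub_eq_zero.2 hJ))
    module
  exact sub_eq_zero.1 ((smul_eq_zero.1 h0).resolve_right hX)

/-- Metric compatibility moves the outer covariant derivative onto `D`. Derivatives then act only on
dual connection terms, which are smooth across `Σ`; the singular behaviour is confined to the last
two products. -/
theorem curvature_eq (hU : IsOpen U) (hq : q ∈ U) (hs : q ∉ singularSet g)
    (hA : SmoothFieldOn U A) (hB : SmoothFieldOn U B) (hC : SmoothFieldOn U C)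
    (hD : SmoothFieldOn U D) :
    curvature g A B C D q =
      mvfderiv (𝓡 m) (dualConn g B C D) q (A q) - mvfderiv (𝓡 m) (dualConn g A C D) q (B q)
      - dualConn g (VectorField.mlieBracket (𝓡 m) A B) C D q
      - g.toFun q (leviCivita g B C q) (leviCivita g A D q)
      + g.toFun q (leviCivita g A C q) (leviCivita g B D q) := by
  have hV : IsOpen (U \ singularSet g) := hU.sdiff (isClosed_singularSet g)
  have hqV : q ∈ U \ singularSet g := ⟨hq, hs⟩
  have key : ∀ {S T : ∀ p : M, TangentSpace (𝓡 m) p}, SmoothFieldOn U S → SmoothFieldOn U T →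
      g.toFun q (leviCivita g S (leviCivita g T C) q) (D q) =
        mvfderiv (𝓡 m) (dualConn g T C D) q (S q) -
        g.toFun q (leviCivita g T C q) (leviCivita g S D q) := by
    intro S T hS hT
    have hTC := (SmoothFieldOn.leviCivita g hU hT hC).diffFieldAt hV hqV
    rw [leviCivita_spec g hs (hS.diffFieldAt hU hq) hTC (hD.diffFieldAt hU hq),
      dualConn_middle_eq, g.symm q (leviCivita g T C q),
      leviCivita_spec g hs (hS.diffFieldAt hU hq) (hD.diffFieldAt hU hq) hTC]
    congr 2
    refine mvfderiv_congr ?_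
    filter_upwards [hV.mem_nhds hqV] with x hx
    exact leviCivita_spec g hx.2 (hT.diffFieldAt hU hx.1) (hC.diffFieldAt hU hx.1)
      (hD.diffFieldAt hU hx.1)
  rw [curvature, map_sub, map_sub, sub_apply, sub_apply, key hA hB, key hB hA,
    leviCivita_spec g hs ((hA.mlieBracket hU hB).diffFieldAt hU hq) (hC.diffFieldAt hU hq)
      (hD.diffFieldAt hU hq)]
  ring

end

/-! ### Tensoriality and symmetries of the curvature off `Σ` -/

noncomputable section

variable {m : ℕ} {M : Type*} [TopologicalSpace M]
  [ChartedSpace (EuclideanSpace ℝ (Fin m)) M] [IsManifold (𝓡 m) ∞ M]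
  {p q : M} {U : Set M} {A A' B C D : ∀ p : M, TangentSpace (𝓡 m) p} {f : M → ℝ}
  (g : SymTensor m M)

theorem curvature_add_left (hU : IsOpen U) (hq : q ∈ U) (hs : q ∉ singularSet g)
    (hA : SmoothFieldOn U A) (hA' : SmoothFieldOn U A') (hB : SmoothFieldOn U B)
    (hC : SmoothFieldOn U C) (hD : SmoothFieldOn U D) :
    curvature g (A + A') B C D q = curvature g A B C D q + curvature g A' B C D q := by
  have hd := fun {X : ∀ p : M, TangentSpace (𝓡 m) p} (hX : SmoothFieldOn U X) =>
    hX.diffFieldAt hU hq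
  have h1 : mvfderiv (𝓡 m) (dualConn g (A + A') C D) q (B q) =
      mvfderiv (𝓡 m) (dualConn g A C D) q (B q) + mvfderiv (𝓡 m) (dualConn g A' C D) q (B q) := by
    have he : dualConn g (A + A') C D =ᶠ[𝓝 q] dualConn g A C D + dualConn g A' C D := by
      filter_upwards [hU.mem_nhds hq] with x hx
      exact (tensorialAt_dualConn_left g (hC.diffFieldAt hU hx) (hD.diffFieldAt hU hx)).add
        (hA.diffFieldAt hU hx) (hA'.diffFieldAt hU hx)
    rw [mvfderiv_congr he, mvfderiv_add
      (mdifferentiableAt_of_contMDiffOn (SmoothFieldOn.dualConn g hU hA hC hD) hU hq)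
      (mdifferentiableAt_of_contMDiffOn (SmoothFieldOn.dualConn g hU hA' hC hD) hU hq)]
    rfl
  have h2 : dualConn g (VectorField.mlieBracket (𝓡 m) (A + A') B) C D q =
      dualConn g (VectorField.mlieBracket (𝓡 m) A B) C D q +
      dualConn g (VectorField.mlieBracket (𝓡 m) A' B) C D q := by
    have hT := tensorialAt_dualConn_left g (hd hC) (hd hD)
    have e1 := hd (hA.mlieBracket hU hB)
    have e2 := hd (hA'.mlieBracket hU hB)
    rw [← hT.add e1 e2]
    exact hT.pointwise (hd ((hA.add hA').mlieBracket hU hB)) (e1.add e2)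
      (VectorField.mlieBracket_add_left (hd hA) (hd hA'))
  rw [curvature_eq g hU hq hs (hA.add hA') hB hC hD, curvature_eq g hU hq hs hA hB hC hD,
    curvature_eq g hU hq hs hA' hB hC hD, h1, h2,
    leviCivita_add_left g hs (hd hA) (hd hA') (hd hC),
    leviCivita_add_left g hs (hd hA) (hd hA') (hd hD)]
  simp only [Pi.add_apply, map_add, add_apply]
  ring

theorem curvature_smul_left (hU : IsOpen U) (hq : q ∈ U) (hs : q ∉ singularSet g)
    (hf : ContMDiffOn (𝓡 m) 𝓘(ℝ, ℝ) ∞ f U) (hA : SmoothFieldOn U A) (hB : SmoothFieldOn U B)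
    (hC : SmoothFieldOn U C) (hD : SmoothFieldOn U D) :
    curvature g (f • A) B C D q = f q * curvature g A B C D q := by
  have hd := fun {X : ∀ p : M, TangentSpace (𝓡 m) p} (hX : SmoothFieldOn U X) =>
    hX.diffFieldAt hU hq
  have hfA := hA.smul hf
  have hfq := mdifferentiableAt_of_contMDiffOn hf hU hq
  have h1 : mvfderiv (𝓡 m) (dualConn g (f • A) C D) q (B q) =
      mvfderiv (𝓡 m) f q (B q) * dualConn g A C D q +
        f q * mvfderiv (𝓡 m) (dualConn g A C D) q (B q) := by
    have he : dualConn g (f • A) C D =ᶠ[𝓝 q] f * dualConn g A C D := by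
      filter_upwards [hU.mem_nhds hq] with x hx
      exact (tensorialAt_dualConn_left g (hC.diffFieldAt hU hx) (hD.diffFieldAt hU hx)).smul
        (mdifferentiableAt_of_contMDiffOn hf hU hx) (hA.diffFieldAt hU hx)
    rw [mvfderiv_congr he, mvfderiv_mul hfq
      (mdifferentiableAt_of_contMDiffOn (SmoothFieldOn.dualConn g hU hA hC hD) hU hq)]
    simp
    ring
  have h2 : dualConn g (VectorField.mlieBracket (𝓡 m) (f • A) B) C D q =
      -mvfderiv (𝓡 m) f q (B q) * dualConn g A C D q +
      f q * dualConn g (VectorField.mlieBracket (𝓡 m) A B) C D q := by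
    have hT := tensorialAt_dualConn_left g (hd hC) (hd hD)
    -- The bracket `[f A, B]` equals `-(B f) A + f [A, B]`. By tensoriality at `q` the coefficient
    -- `B f` may be replaced by its value there.
    have e0 : MDifferentiableAt (𝓡 m) 𝓘(ℝ, ℝ) (fun _ : M => -mvfderiv (𝓡 m) f q (B q)) q :=
      mdifferentiableAt_const
    have e1 := DiffFieldAt.smul e0 (hd hA)
    have e3 := hd (hA.mlieBracket hU hB)
    have e2 := DiffFieldAt.smul hfq e3
    have h3 := hT.add e1 e2
    rw [hT.smul e0 (hd hA), hT.smul hfq e3] at h3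
    refine (hT.pointwise (hd (hfA.mlieBracket hU hB)) (e1.add e2) ?_).trans h3
    exact VectorField.mlieBracket_smul_left hfq (hd hA)
  rw [curvature_eq g hU hq hs hfA hB hC hD, curvature_eq g hU hq hs hA hB hC hD, h1, h2,
    leviCivita_smul_left g hs hfq (hd hA) (hd hC), leviCivita_smul_left g hs hfq (hd hA) (hd hD)]
  simp only [Pi.smul_apply', map_smul, smul_apply, smul_eq_mul]
  ring

theorem curvature_swap_left (hU : IsOpen U) (hq : q ∈ U) (hs : q ∉ singularSet g)
    (hA : SmoothFieldOn U A) (hB : SmoothFieldOn U B) (hC : SmoothFieldOn U C)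
    (hD : SmoothFieldOn U D) :
    curvature g A B C D q = -curvature g B A C D q := by
  have hd := fun {X : ∀ p : M, TangentSpace (𝓡 m) p} (hX : SmoothFieldOn U X) =>
    hX.diffFieldAt hU hq
  have h2 : dualConn g (VectorField.mlieBracket (𝓡 m) B A) C D q =
      -dualConn g (VectorField.mlieBracket (𝓡 m) A B) C D q := by
    have hT := tensorialAt_dualConn_left g (hd hC) (hd hD)
    have e0 : MDifferentiableAt (𝓡 m) 𝓘(ℝ, ℝ) (fun _ : M => (-1 : ℝ)) q := mdifferentiableAt_const
    have e1 := hd (hA.mlieBracket hU hB)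
    have h3 := hT.smul e0 e1
    rw [smul_eq_mul, neg_one_mul] at h3
    rw [← h3]
    refine hT.pointwise (hd (hB.mlieBracket hU hA)) (DiffFieldAt.smul e0 e1) ?_
    rw [VectorField.mlieBracket_swap_apply]
    simp
  rw [curvature_eq g hU hq hs hA hB hC hD, curvature_eq g hU hq hs hB hA hC hD, h2]
  ring

/-- The part symmetric in `C, D` is the commutator of `A` and `B` on the function `⟨C,D⟩`, minus the
action of `[A,B]` on it. -/
theorem curvature_swap_right (hU : IsOpen U) (hq : q ∈ U) (hs : q ∉ singularSet g)
    (hA : SmoothFieldOn U A) (hB : SmoothFieldOn U B) (hC : SmoothFieldOn U C)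
    (hD : SmoothFieldOn U D) :
    curvature g A B C D q = -curvature g A B D C q := by
  -- The commutator formula needs a nonzero tangent vector; without one, both sides are zero.
  by_cases hX : ∃ X : TangentSpace (𝓡 m) q, X ≠ 0
  · obtain ⟨X, hX⟩ := hX
    have key := mvfderiv_mlieBracket hU hq hA hB (hC.pair g hD) hX
    have h1 : ∀ {S T : ∀ p : M, TangentSpace (𝓡 m) p}, SmoothFieldOn U S → SmoothFieldOn U T →
        mvfderiv (𝓡 m) (fun x => mvfderiv (𝓡 m) (pair g C D) x (S x)) q (T q) =
          mvfderiv (𝓡 m) (dualConn g S C D) q (T q) +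
          mvfderiv (𝓡 m) (dualConn g S D C) q (T q) := by
      intro S T hS hT
      have he : (fun x => mvfderiv (𝓡 m) (pair g C D) x (S x)) =
          dualConn g S C D + dualConn g S D C :=
        funext fun x => (dualConn_add_swap g S C D x).symm
      rw [he, mvfderiv_add
        (mdifferentiableAt_of_contMDiffOn (SmoothFieldOn.dualConn g hU hS hC hD) hU hq)
        (mdifferentiableAt_of_contMDiffOn (SmoothFieldOn.dualConn g hU hS hD hC) hU hq)]
      rfl
    rw [h1 hA hB, h1 hB hA, ← dualConn_add_swap] at key
    rw [curvature_eq g hU hq hs hA hB hC hD, curvature_eq g hU hq hs hA hB hD hC,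
      g.symm q (leviCivita g B D q), g.symm q (leviCivita g A D q)]
    linarith
  · push Not at hX
    rw [curvature, curvature, hX (C q), hX (D q)]
    simp

/-! ### The curvature multiplied by the determinant of the Gram matrix -/

/-- The smooth extension of `det (g_ij) ⟨R(A,B)C,D⟩` to the domain of the frame at `p`. -/
def scaledCurvature (p : M) (A B C D : ∀ p : M, TangentSpace (𝓡 m) p) (q : M) : ℝ :=
  (gram g p q).det * (mvfderiv (𝓡 m) (dualConn g B C D) q (A q)
      - mvfderiv (𝓡 m) (dualConn g A C D) q (B q)
      - dualConn g (VectorField.mlieBracket (𝓡 m) A B) C D q)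
    - ∑ i, ∑ j, (gram g p q).adjugate i j *
      (dualConn g B C (frame p j) q * dualConn g A D (frame p i) q
        - dualConn g A C (frame p j) q * dualConn g B D (frame p i) q)

theorem contMDiffOn_scaledCurvature (hU : IsOpen U) (hUp : U ⊆ frameSet m p)
    (hA : SmoothFieldOn U A) (hB : SmoothFieldOn U B) (hC : SmoothFieldOn U C)
    (hD : SmoothFieldOn U D) :
    ContMDiffOn (𝓡 m) 𝓘(ℝ, ℝ) ∞ (scaledCurvature g p A B C D) U := by
  have hG : ∀ i j, ContMDiffOn (𝓡 m) 𝓘(ℝ, ℝ) ∞ (fun x => gram g p x i j) U := fun i j =>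
    (contMDiffOn_gram g p i j).mono hUp
  have hE := fun i => (smoothFieldOn_frame p i).mono hUp
  refine ((contMDiffOn_det hG).mul (((SmoothFieldOn.mvfderiv hU
    (SmoothFieldOn.dualConn g hU hB hC hD) hA).sub (SmoothFieldOn.mvfderiv hU
    (SmoothFieldOn.dualConn g hU hA hC hD) hB)).sub
    (SmoothFieldOn.dualConn g hU (hA.mlieBracket hU hB) hC hD))).sub
    (contMDiffOn_finsetSum fun i _ => contMDiffOn_finsetSum fun j _ =>
      (contMDiffOn_adjugate hG i j).mul ?_)
  exact ((SmoothFieldOn.dualConn g hU hB hC (hE j)).mul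
    (SmoothFieldOn.dualConn g hU hA hD (hE i))).sub
    ((SmoothFieldOn.dualConn g hU hA hC (hE j)).mul (SmoothFieldOn.dualConn g hU hB hD (hE i)))

/-- The product `⟨∇_S C, ∇_T D⟩` is `□_T D` evaluated on `∇_S C`, whose frame components are `(det
G)⁻¹ adj G` applied to those of `□_S C`. Multiplying by `det G` removes the denominator. -/
theorem scaledCurvature_eq (hU : IsOpen U) (hq : q ∈ U) (hqp : q ∈ frameSet m p)
    (hs : q ∉ singularSet g)
    (hA : SmoothFieldOn U A) (hB : SmoothFieldOn U B) (hC : SmoothFieldOn U C)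
    (hD : SmoothFieldOn U D) :
    scaledCurvature g p A B C D q = (gram g p q).det * curvature g A B C D q := by
  have hd : (gram g p q).det ≠ 0 := fun h => hs ((mem_singularSet_iff g hqp).2 h)
  have key : ∀ {S T : ∀ p : M, TangentSpace (𝓡 m) p}, SmoothFieldOn U S → SmoothFieldOn U T →
      (gram g p q).det * g.toFun q (leviCivita g S C q) (leviCivita g T D q) =
        ∑ i, ∑ j, (gram g p q).adjugate i j *
          (dualConn g S C (frame p j) q * dualConn g T D (frame p i) q) := by
    intro S T hS hT
    have hSC : DiffFieldAt (leviCivita g S C) q :=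
      (SmoothFieldOn.leviCivita g hU hS hC).diffFieldAt (hU.sdiff (isClosed_singularSet g))
        ⟨hq, hs⟩
    rw [g.symm, leviCivita_spec g hs (hT.diffFieldAt hU hq) (hD.diffFieldAt hU hq) hSC,
      dualConn_eq_sum g hqp (hT.diffFieldAt hU hq) (hD.diffFieldAt hU hq) hSC,
      leviCivita_eq_frameConn g hqp hs (hS.diffFieldAt hU hq) (hC.diffFieldAt hU hq), frameConn]
    simp only [frameCoeff_sum hqp]
    rw [Finset.mul_sum]
    refine Finset.sum_congr rfl fun i _ => ?_
    rw [← mul_assoc, ← mul_assoc, mul_inv_cancel₀ hd, one_mul, Finset.sum_mul]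
    exact Finset.sum_congr rfl fun j _ => mul_assoc _ _ _
  rw [curvature_eq g hU hq hs hA hB hC hD, scaledCurvature]
  simp only [mul_sub, mul_add, Finset.sum_sub_distrib]
  rw [key hB hA, key hA hB]
  ring

/-! ### Behaviour at the singular set -/

theorem gram_mulVec_radical (hq : q ∈ frameSet m p) {r : TangentSpace (𝓡 m) q}
    (hr : r ∈ radical g q) : (gram g p q).mulVec (fun j => frameCoeff p j q r) = 0 :=
  funext fun i => by rw [gram_mulVec g hq]; exact hr _

theorem frameCoeff_ne_zero (hq : q ∈ frameSet m p) {r : TangentSpace (𝓡 m) q}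
    (hr : r ≠ 0) : (fun j => frameCoeff p j q r) ≠ 0 := by
  intro h0
  apply hr
  rw [← sum_frameCoeff hq r]
  exact Finset.sum_eq_zero fun i _ => by rw [congrFun h0 i]; simp

theorem sum_frameCoeff_mul_dualConn (hq : q ∈ frameSet m p) {r : TangentSpace (𝓡 m) q}
    (hr : r ∈ radical g q) (hA : DiffFieldAt A q) (hB : DiffFieldAt B q) :
    ∑ i, frameCoeff p i q r * dualConn g A B (frame p i) q = II g r (A q) (B q) := by
  have h1 := II_eq_dualConn g hA hB (diffFieldAt_extend r) (by simpa)
  rw [dualConn_eq_sum g hq hA hB (diffFieldAt_extend r)] at h1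
  simp only [FiberBundle.extend_apply_self] at h1
  exact h1.symm

/-- On `Σ` the determinant factor vanishes, and the rank-one adjugate contracts each dual connection
with `r`, turning it into `II_r`. -/
theorem scaledCurvature_eq_Upsilon (hqp : q ∈ frameSet m p) (hs : q ∈ singularSet g)
    (hA : DiffFieldAt A q) (hB : DiffFieldAt B q) (hC : DiffFieldAt C q) (hD : DiffFieldAt D q)
    {r : TangentSpace (𝓡 m) q} (hr : r ∈ radical g q) {c : ℝ}
    (hc : ∀ i j, (gram g p q).adjugate i j = c * (frameCoeff p i q r * frameCoeff p j q r)) :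
    scaledCurvature g p A B C D q = c * Upsilon g r (A q) (B q) (C q) (D q) := by
  have key : ∀ {S T : ∀ p : M, TangentSpace (𝓡 m) p}, DiffFieldAt S q → DiffFieldAt T q →
      ∑ i, ∑ j, (gram g p q).adjugate i j *
          (dualConn g S C (frame p j) q * dualConn g T D (frame p i) q) =
        c * (II g r (S q) (C q) * II g r (T q) (D q)) := by
    intro S T hS hT
    rw [← sum_frameCoeff_mul_dualConn g hqp hr hS hC, ← sum_frameCoeff_mul_dualConn g hqp hr hT hD,
      mul_comm (∑ i, _), Finset.sum_mul_sum, Finset.mul_sum]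
    refine Finset.sum_congr rfl fun i _ => ?_
    rw [Finset.mul_sum]
    refine Finset.sum_congr rfl fun j _ => ?_
    rw [hc]
    ring
  rw [scaledCurvature, (mem_singularSet_iff g hqp).1 hs, Upsilon, Matrix.det_fin_two_of]
  simp only [mul_sub, Finset.sum_sub_distrib]
  rw [key hB hA, key hA hB]
  ring

/-- A single constant governs both the adjugate and the differential of `det G`. It translates
transversality into `c ≠ 0` and into the nonvanishing of `II_r(·, r)`. -/
theorem exists_adjugate_gram_eq (hq : q ∈ frameSet m p) {r : TangentSpace (𝓡 m) q}
    (hr : r ∈ radical g q) (hr0 : r ≠ 0) :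
    ∃ c : ℝ, (∀ i j, (gram g p q).adjugate i j = c * (frameCoeff p i q r * frameCoeff p j q r)) ∧
      ∀ v : TangentSpace (𝓡 m) q,
        mvfderiv (𝓡 m) (fun x => (gram g p x).det) q v = 2 * c * II g r v r := by
  obtain ⟨c, hc⟩ := exists_adjugate_eq_of_mulVec_eq_zero (gram_isSymm g p q)
    (frameCoeff_ne_zero hq hr0) (gram_mulVec_radical g hq hr)
  refine ⟨c, hc, fun v => ?_⟩
  set a : Fin m → ℝ := fun j => frameCoeff p j q r with ha
  obtain ⟨k, hk⟩ := Function.ne_iff.1 (frameCoeff_ne_zero hq hr0)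
  have hk : a k ≠ 0 := hk
  set R : ∀ x : M, TangentSpace (𝓡 m) x := fun x => ∑ i, a i • frame p i x with hR
  have hRq : R q = r := sum_frameCoeff hq r
  have hRd : DiffFieldAt R q := diffFieldAt_sum_frame a hq
  set X := FiberBundle.extend (EuclideanSpace ℝ (Fin m)) v
  have hX : DiffFieldAt X q := diffFieldAt_extend v
  have hXq : X q = v := FiberBundle.extend_apply_self _ _
  have hmd : ∀ {h : M → ℝ}, ContMDiffOn (𝓡 m) 𝓘(ℝ, ℝ) ∞ h (frameSet m p) →
      MDifferentiableAt (𝓡 m) 𝓘(ℝ, ℝ) h q := fun hh =>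
    mdifferentiableAt_of_contMDiffOn hh (isOpen_frameSet p) hq
  have hA := fun j => hmd (contMDiffOn_adjugate (contMDiffOn_gram g p) j k)
  have hu := fun j => hRd.pair g (diffFieldAt_frame hq j)
  have hdet := hmd (contMDiffOn_det (contMDiffOn_gram g p))
  -- Entry `k` of `aᵀ G adj G = (det G) aᵀ`, where `R` has the constant coefficients `a` of `r`.
  have hid : (fun x => ∑ j, pair g R (frame p j) x * (gram g p x).adjugate j k) =
      fun x => a k * (gram g p x).det := by
    funext x
    have h1 : ∀ j, pair g R (frame p j) x = Matrix.vecMul a (gram g p x) j := by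
      intro j
      simp [pair, hR, Matrix.vecMul, dotProduct, gram]
    simp only [h1]
    have h2 : Matrix.vecMul (Matrix.vecMul a (gram g p x)) (gram g p x).adjugate k =
        a k * (gram g p x).det := by
      rw [Matrix.vecMul_vecMul, Matrix.mul_adjugate, Matrix.vecMul_smul, Matrix.vecMul_one]
      simp [mul_comm]
    exact h2
  have hderiv := congrArg (fun h => mvfderiv (𝓡 m) h q v) hid
  have hsum : mvfderiv (𝓡 m) (fun x => ∑ j, pair g R (frame p j) x * (gram g p x).adjugate j k) q v
      = ∑ j, mvfderiv (𝓡 m) (pair g R (frame p j)) q v * (gram g p q).adjugate j k := by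
    have hs : ∀ s : Finset (Fin m),
        MDifferentiableAt (𝓡 m) 𝓘(ℝ, ℝ)
          (fun x => ∑ j ∈ s, pair g R (frame p j) x * (gram g p x).adjugate j k) q ∧
        mvfderiv (𝓡 m) (fun x => ∑ j ∈ s, pair g R (frame p j) x * (gram g p x).adjugate j k) q v
          = ∑ j ∈ s, mvfderiv (𝓡 m) (pair g R (frame p j)) q v * (gram g p q).adjugate j k := by
      intro s
      induction s using Finset.induction_on with
      | empty => exact ⟨by simpa using mdifferentiableAt_const, by simp [mvfderiv_const]⟩
      | insert j s hj ih =>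
        have hj' : MDifferentiableAt (𝓡 m) 𝓘(ℝ, ℝ)
            (fun x => pair g R (frame p j) x * (gram g p x).adjugate j k) q := (hu j).mul (hA j)
        simp only [Finset.sum_insert hj]
        refine ⟨hj'.add ih.1, ?_⟩
        -- Since `R q = r` is radical, this factor vanishes at `q`, so no derivative of the adjugate
        -- survives.
        have h0 : pair g R (frame p j) q = 0 := by rw [pair, hRq]; exact hr _
        rw [mvfderiv_fun_add hj' ih.1, add_apply, ih.2, mvfderiv_fun_mul (hu j) (hA j), h0]
        simp [mul_comm]
    exact (hs Finset.univ).2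
  have hdc : mvfderiv (𝓡 m) (fun x => a k * (gram g p x).det) q v =
      a k * mvfderiv (𝓡 m) (fun x => (gram g p x).det) q v := by
    have hconst : MDifferentiableAt (𝓡 m) 𝓘(ℝ, ℝ) (fun _ : M => a k) q := mdifferentiableAt_const
    rw [mvfderiv_fun_mul hconst hdet, mvfderiv_const]
    simp
  -- Compatibility splits `d⟨R, E_j⟩` into two dual connection terms; contracted with `a`, each
  -- gives `II_r(v, r)`.
  have hpair : ∑ j, a j * mvfderiv (𝓡 m) (pair g R (frame p j)) q v = 2 * II g r v r := by
    have h1 : ∀ j, mvfderiv (𝓡 m) (pair g R (frame p j)) q v =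
        dualConn g X R (frame p j) q + dualConn g X (frame p j) R q := by
      intro j
      rw [dualConn_add_swap, hXq]
    have hRr : R q ∈ radical g q := by rwa [hRq]
    have h2 := sum_frameCoeff_mul_dualConn g hq hr hX hRd
    rw [hXq, hRq] at h2
    have hT := tensorialAt_dualConn_middle g hX hRd hRr
    have h3 : ∑ j, a j * dualConn g X (frame p j) R q = dualConn g X R R q := by
      have hcst : ∀ j, MDifferentiableAt (𝓡 m) 𝓘(ℝ, ℝ) (fun _ : M => a j) q :=
        fun j => mdifferentiableAt_const
      have := hT.sum (s := Finset.univ) (fun j => (fun _ : M => a j) • frame p j)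
        fun j _ => DiffFieldAt.smul (hcst j) (diffFieldAt_frame hq j)
      refine Eq.trans (Finset.sum_congr rfl fun j _ => ?_) this.symm
      exact (hT.smul (hcst j) (diffFieldAt_frame hq j)).symm
    have h4 := II_eq_dualConn g hX hRd hRd hRr
    rw [hXq, hRq] at h4
    simp only [h1, mul_add, Finset.sum_add_distrib]
    rw [h3, ← h4, h2]
    ring
  rw [hsum, hdc] at hderiv
  have h5 : ∑ j, mvfderiv (𝓡 m) (pair g R (frame p j)) q v * (gram g p q).adjugate j k =
      a k * (2 * c * II g r v r) := by
    calc _ = ∑ j, a k * c * (a j * mvfderiv (𝓡 m) (pair g R (frame p j)) q v) :=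
          Finset.sum_congr rfl fun j _ => by rw [hc]; ring
      _ = _ := by rw [← Finset.mul_sum, hpair]; ring
  exact mul_left_cancel₀ hk (hderiv.symm.trans h5)

/-! ### Transversality in terms of the Gram determinant -/

/-- Identifies the bundle frame with the coordinate vectors in `coordDet`, so that the
transversality hypothesis applies to the Gram determinant. -/
theorem frame_eq_mfderiv {x : EuclideanSpace ℝ (Fin m)}
    (hx : x ∈ (chartAt (EuclideanSpace ℝ (Fin m)) p).target) (i : Fin m) :
    frame p i ((chartAt (EuclideanSpace ℝ (Fin m)) p).symm x) =
      mfderiv 𝓘(ℝ, EuclideanSpace ℝ (Fin m)) (𝓡 m) (chartAt (EuclideanSpace ℝ (Fin m)) p).symm x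
        (EuclideanSpace.single i (1 : ℝ)) := by
  set e := chartAt (EuclideanSpace ℝ (Fin m)) p with he
  have hq : e.symm x ∈ e.source := e.map_target hx
  have h1 := TangentBundle.symmL_trivializationAt (I := 𝓡 m) hq
  have hq' : e.symm x ∈ frameSet m p := hq
  rw [frame, Trivialization.localFrame_apply_of_mem_baseSet _ _ hq']
  have h2 := congrArg (fun L => L (EuclideanSpace.single i (1 : ℝ))) h1
  have h3 : extChartAt (𝓡 m) p (e.symm x) = x := e.right_inv hx
  have h4 : Set.range (𝓡 m) = Set.univ := ModelWithCorners.range_eq_univ _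
  rw [h3, h4, mfderivWithin_univ] at h2
  refine Eq.trans ?_ h2
  simp only [Trivialization.basisAt]
  rw [Trivialization.symmL_apply _ hq']
  simp
  rfl

theorem mvfderiv_det_gram_ne_zero (hg : IsTransverseRiemannLorentz g) (hq : q ∈ frameSet m p)
    (hs : q ∈ singularSet g) : mvfderiv (𝓡 m) (fun x => (gram g p x).det) q ≠ 0 := by
  intro h0
  set e := chartAt (EuclideanSpace ℝ (Fin m)) p with he
  have hqe : q ∈ e.source := hq
  have hea : e ∈ IsManifold.maximalAtlas (𝓡 m) ∞ M := IsManifold.chart_mem_maximalAtlas p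
  refine hg.transverse e hea q hqe hs ?_
  have heq : coordDet g e =ᶠ[𝓝 (e q)] (fun x => (gram g p x).det) ∘ e.symm := by
    filter_upwards [e.open_target.mem_nhds (e.map_source hqe)] with x hx
    rw [coordDet, Function.comp_apply]
    congr 1
    ext i j
    simp only [Matrix.of_apply, gram]
    rw [he, frame_eq_mfderiv hx, frame_eq_mfderiv hx]
  rw [heq.fderiv_eq, ← mfderiv_eq_fderiv]
  have hdet : MDifferentiableAt (𝓡 m) 𝓘(ℝ, ℝ) (fun x => (gram g p x).det) (e.symm (e q)) := by
    rw [e.left_inv hqe]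
    exact mdifferentiableAt_of_contMDiffOn (contMDiffOn_det (contMDiffOn_gram g p))
      (isOpen_frameSet p) hq
  have hsymm : MDifferentiableAt 𝓘(ℝ, EuclideanSpace ℝ (Fin m)) (𝓡 m) e.symm (e q) :=
    ((contMDiffOn_symm_of_mem_maximalAtlas hea).contMDiffAt
      (e.open_target.mem_nhds (e.map_source hqe))).mdifferentiableAt (by simp)
  have h1 := mvfderiv_comp (e q) hdet hsymm
  rw [e.left_inv hqe, h0] at h1
  ext v
  exact congrArg (fun L => L v) h1

end

section

variable {m : ℕ} {M : Type*} [TopologicalSpace M]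
  [ChartedSpace (EuclideanSpace ℝ (Fin m)) M] [IsManifold (𝓡 m) ∞ M]
  {p q : M} {U : Set M} {A A' B C D : ∀ p : M, TangentSpace (𝓡 m) p} {f : M → ℝ}
  {g : SymTensor m M}

/-! ### Tangent vectors of the singular set and main pairs -/

theorem exists_II_ne_zero (hg : IsTransverseRiemannLorentz g) (hs : q ∈ singularSet g)
    {r : TangentSpace (𝓡 m) q} (hr : r ∈ radical g q) (hr0 : r ≠ 0) : ∃ v, II g r v r ≠ 0 := by
  obtain ⟨c, -, hc⟩ := exists_adjugate_gram_eq g (mem_frameSet q) hr hr0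
  by_contra! h
  refine mvfderiv_det_gram_ne_zero g hg (mem_frameSet q) hs ?_
  ext v
  rw [hc, h v]
  simp

theorem adjugate_coeff_ne_zero (hg : IsTransverseRiemannLorentz g) (hq : q ∈ frameSet m p)
    (hs : q ∈ singularSet g) {r : TangentSpace (𝓡 m) q} {c : ℝ}
    (hc : ∀ v : TangentSpace (𝓡 m) q,
        mvfderiv (𝓡 m) (fun x => (gram g p x).det) q v = 2 * c * II g r v r) : c ≠ 0 := by
  rintro rfl
  refine mvfderiv_det_gram_ne_zero g hg hq hs ?_
  ext v
  rw [hc]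
  simp

/-- Both conditions say `d(det G)(v) = 0`. A cut-off of `det G` is a test function vanishing on `Σ`;
conversely every such function is locally `h det G`, so its differential at `q` is a multiple of
`d(det G)`. -/
theorem mem_tangentSigma_iff [T2Space M] (hg : IsTransverseRiemannLorentz g)
    (hs : q ∈ singularSet g) {r : TangentSpace (𝓡 m) q} (hr : r ∈ radical g q) (hr0 : r ≠ 0)
    (v : TangentSpace (𝓡 m) q) : v ∈ tangentSigma g q ↔ II g r v r = 0 := by
  obtain ⟨c, -, hc⟩ := exists_adjugate_gram_eq g (mem_frameSet q) hr hr0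
  have hc0 := adjugate_coeff_ne_zero hg (mem_frameSet q) hs hc
  have hdet := contMDiffOn_det (contMDiffOn_gram g q)
  have hdq : (gram g q q).det = 0 := (mem_singularSet_iff g (mem_frameSet q)).1 hs
  constructor
  · intro hv
    obtain ⟨χ⟩ : Nonempty (SmoothBumpFunction (𝓡 m) q) := inferInstance
    have h1 := hv (fun x => χ x • (gram g q x).det) (χ.contMDiff_smul hdet) (fun x hx => by
      by_cases hxs : x ∈ frameSet m q
      · rw [(mem_singularSet_iff g hxs).1 hx, smul_zero]
      · have : χ x = 0 := by
          by_contra h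
          exact hxs (χ.support_subset_source h)
        rw [this, zero_smul])
    have h2 : (fun x => χ x • (gram g q x).det) =ᶠ[𝓝 q] fun x => (gram g q x).det := by
      filter_upwards [χ.eventuallyEq_one] with x hx
      simp [hx]
    rw [mvfderiv_congr h2, hc] at h1
    simpa [hc0] using h1
  · intro hv f hf h0
    obtain ⟨V, hV, hqV, hVU, h, hh, hfh⟩ := exists_eq_mul_of_mvfderiv_ne_zero (isOpen_frameSet q)
      (mem_frameSet q) hf.contMDiffOn hdet
      (fun _ => mvfderiv_det_gram_ne_zero g hg (mem_frameSet q) hs)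
      (fun x hx hx0 => h0 x ((mem_singularSet_iff g hx).2 hx0))
    have h2 : f =ᶠ[𝓝 q] fun x => h x * (gram g q x).det := by
      filter_upwards [hV.mem_nhds hqV] with x hx using hfh x hx
    rw [mvfderiv_congr h2, mvfderiv_fun_mul (mdifferentiableAt_of_contMDiffOn hh hV hqV)
      (mdifferentiableAt_of_contMDiffOn hdet (isOpen_frameSet q) (mem_frameSet q)), hdq]
    simp [hc, hv]

/-- A negative value would persist nearby, contradicting that `q` is a limit of Riemannian points.
-/
theorem posSemidef_of_mem_singularSet (hg : IsTransverseRiemannLorentz g)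
    (hs : q ∈ singularSet g) (v : TangentSpace (𝓡 m) q) : 0 ≤ g.toFun q v v := by
  by_contra! hlt
  set V := FiberBundle.extend (EuclideanSpace ℝ (Fin m)) v
  have hV : DiffFieldAt V q := diffFieldAt_extend v
  have hcont : ContinuousAt (pair g V V) q := (hV.pair g hV).continuousAt
  have hVq : V q = v := FiberBundle.extend_apply_self _ _
  have h1 : pair g V V q < 0 := by rwa [pair, hVq]
  have h2 := hcont.eventually (gt_mem_nhds h1)
  obtain ⟨x, hx, hneg⟩ := ((mem_closure_iff_frequently.1 (hg.changes q hs).1).and_eventually h2).exists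
  by_cases h0 : V x = 0
  · simp [pair, h0] at hneg
  · exact absurd (hx (V x) h0) (not_lt.2 hneg.le)

/-- The adjugate is both `c r rᵀ` and `c' w wᵀ` with nonzero constants; comparing one column gives
the factor. -/
theorem exists_eq_smul_of_mem_radical (hg : IsTransverseRiemannLorentz g)
    (hs : q ∈ singularSet g) {r w : TangentSpace (𝓡 m) q} (hr : r ∈ radical g q) (hr0 : r ≠ 0)
    (hw : w ∈ radical g q) : ∃ t : ℝ, w = t • r := by
  by_cases hw0 : w = 0
  · exact ⟨0, by rw [hw0, zero_smul]⟩
  obtain ⟨c, ha, hc⟩ := exists_adjugate_gram_eq g (mem_frameSet q) hr hr0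
  have hc0 := adjugate_coeff_ne_zero hg (mem_frameSet q) hs hc
  obtain ⟨c', ha', hc'⟩ := exists_adjugate_gram_eq g (mem_frameSet q) hw hw0
  have hc0' := adjugate_coeff_ne_zero hg (mem_frameSet q) hs hc'
  obtain ⟨k, hk⟩ := Function.ne_iff.1 (frameCoeff_ne_zero (mem_frameSet q) hw0)
  have hk : frameCoeff q k q w ≠ 0 := hk
  refine ⟨c * frameCoeff q k q r / (c' * frameCoeff q k q w), ?_⟩
  rw [← sum_frameCoeff (mem_frameSet q) w, ← sum_frameCoeff (mem_frameSet q) r, Finset.smul_sum]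
  refine Finset.sum_congr rfl fun i _ => ?_
  rw [smul_smul, sum_frameCoeff (mem_frameSet q) w, sum_frameCoeff (mem_frameSet q) r]
  congr 1
  have h1 := (ha' i k).symm.trans (ha i k)
  field_simp
  linarith

/-- Adding `ψ ⊗ ψ` with `ψ r = 1` makes the form nondegenerate. Evaluating the solution for `l` on
`r` gives `ψ n = l r = 0`, so the added term contributes nothing. -/
theorem exists_toFun_eq (hg : IsTransverseRiemannLorentz g)
    (hs : q ∈ singularSet g) {r : TangentSpace (𝓡 m) q} (hr : r ∈ radical g q) (hr0 : r ≠ 0)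
    (l : TangentSpace (𝓡 m) q →ₗ[ℝ] ℝ) (hl : l r = 0) :
    ∃ n : TangentSpace (𝓡 m) q, ∀ v, g.toFun q n v = l v := by
  have : FiniteDimensional ℝ (TangentSpace (𝓡 m) q) :=
    inferInstanceAs (FiniteDimensional ℝ (EuclideanSpace ℝ (Fin m)))
  obtain ⟨k, hk⟩ := Function.ne_iff.1 (frameCoeff_ne_zero (mem_frameSet q) hr0)
  have hk : frameCoeff q k q r ≠ 0 := hk
  let ψ : TangentSpace (𝓡 m) q →ₗ[ℝ] ℝ := (frameCoeff q k q r)⁻¹ • frameCoeff q k q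
  have hψ : ψ r = 1 := by simp [ψ, hk]
  let T : TangentSpace (𝓡 m) q →ₗ[ℝ] Module.Dual ℝ (TangentSpace (𝓡 m) q) :=
    { toFun := fun n => (g.toFun q n).toLinearMap + ψ n • ψ
      map_add' := fun a b => by ext v; simp; ring
      map_smul' := fun t a => by ext v; simp; ring }
  have hT : ∀ n v, T n v = g.toFun q n v + ψ n * ψ v := fun n v => rfl
  have hinj : Function.Injective T := by
    refine (injective_iff_map_eq_zero T).2 fun n hn => ?_
    have h1 : ψ n = 0 := by
      have := hT n r
      rw [hn, hψ, g.symm, hr] at this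
      simpa using this.symm
    have h2 : n ∈ radical g q := fun v => by
      have := hT n v
      rw [hn, h1] at this
      simpa using this.symm
    obtain ⟨t, rfl⟩ := exists_eq_smul_of_mem_radical hg hs hr hr0 h2
    rw [map_smul, hψ, smul_eq_mul, mul_one] at h1
    rw [h1, zero_smul]
  obtain ⟨n, hn⟩ := (LinearMap.injective_iff_surjective_of_finrank_eq_finrank
    (Subspace.dual_finrank_eq).symm).1 hinj l
  refine ⟨n, fun v => ?_⟩
  have h1 : ψ n = 0 := by
    have := hT n r
    rw [hn, hl, hψ, g.symm, hr] at this
    simpa using this.symm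
  have := hT n v
  rw [hn, h1] at this
  simpa using this.symm

theorem exists_radical_ne_zero (hs : q ∈ singularSet g) : ∃ r ∈ radical g q, r ≠ 0 :=
  (Submodule.ne_bot_iff _).1 hs

theorem exists_isMainPair [T2Space M] (hg : IsTransverseRiemannLorentz g)
    (hs : q ∈ singularSet g) : ∃ n r : TangentSpace (𝓡 m) q, IsMainPair g n r := by
  obtain ⟨r, hr, hr0⟩ := exists_radical_ne_zero hs
  have hrr : II g r r r = 0 := (mem_tangentSigma_iff hg hs hr hr0 r).1 (hg.tangent q hs hr)
  -- Tangency of the radical is exactly the condition `II_r(r,r) = 0` that makes `v ↦ II_r(v,r)`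
  -- representable. The representing vector is normal to `Σ`.
  obtain ⟨n₀, hn₀⟩ := exists_toFun_eq hg hs hr hr0
    { toFun := fun v => II g r v r
      map_add' := fun a b => II_add_left g hr a b r
      map_smul' := fun t a => II_smul_left g hr t a r } hrr
  have hn₀ : ∀ v, g.toFun q n₀ v = II g r v r := hn₀
  have hpos : 0 < g.toFun q n₀ n₀ := by
    refine lt_of_le_of_ne (posSemidef_of_mem_singularSet hg hs n₀) fun h0 => ?_
    obtain ⟨v, hv⟩ := exists_II_ne_zero hg hs hr hr0
    -- If `n₀` were null, semidefiniteness along `n₀ + t • v` would force `⟨n₀, v⟩ = II_r(v,r) = 0`,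
    -- against transversality.
    have h1 : ∀ t : ℝ, 0 ≤ g.toFun q v v * (t * t) + (2 * g.toFun q n₀ v) * t + 0 := by
      intro t
      have := posSemidef_of_mem_singularSet hg hs (n₀ + t • v)
      simp only [map_add, add_apply, map_smul, smul_apply, smul_eq_mul, ← h0,
        g.symm q v n₀] at this
      linarith
    have h2 := discrim_le_zero h1
    rw [discrim, ← hn₀ v] at *
    have h3 : (g.toFun q n₀ v) ^ 2 ≤ 0 := by nlinarith
    exact hv (pow_eq_zero_iff two_ne_zero |>.1 (le_antisymm h3 (sq_nonneg _)))
  set a := Real.sqrt (g.toFun q n₀ n₀) with ha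
  have ha0 : 0 < a := Real.sqrt_pos.2 hpos
  have haa : a * a = g.toFun q n₀ n₀ := Real.mul_self_sqrt hpos.le
  obtain ⟨n₁, hn₁⟩ : ∃ x, x = a⁻¹ • n₀ := ⟨_, rfl⟩
  have hn₁v : ∀ v, g.toFun q n₁ v = a⁻¹ * II g r v r := fun v => by
    rw [hn₁, map_smul, smul_apply, hn₀, smul_eq_mul]
  have hb : II g r n₁ r = a := by
    rw [hn₁, II_smul_left g hr, ← hn₀, ← haa]
    field_simp
  -- Adding `s • r` leaves `⟨n₁, ·⟩` unchanged and changes `II(n₁,n₁)` by `2 s a`; this `s` makes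
  -- the sum zero.
  obtain ⟨s, hsdef⟩ : ∃ x, x = -(II g r n₁ n₁) / (2 * a) := ⟨_, rfl⟩
  obtain ⟨n, hn⟩ : ∃ x, x = n₁ + s • r := ⟨_, rfl⟩
  have hnr : II g r n r = a := by
    rw [hn, II_add_left g hr, II_smul_left g hr, hrr, hb, mul_zero, add_zero]
  have hgn : ∀ v, g.toFun q n v = a⁻¹ * II g r v r := fun v => by
    rw [hn, map_add, add_apply, map_smul, smul_apply, hr v, smul_zero, add_zero, hn₁v]
  have hnn : II g r n n = 0 := by
    have h1 : II g r r n₁ = a := by rw [II_comm g hr, hb]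
    rw [hn, II_add_left g hr, II_add_right g hr, II_add_right g hr, II_smul_left g hr,
      II_smul_left g hr, II_smul_right g hr, II_smul_right g hr, hrr, hb, h1, hsdef]
    field_simp
    ring
  -- Replacing `r` by `t • r` multiplies `𝓗(r,r) = -a` by `t²`.
  set t := (Real.sqrt a)⁻¹ with ht
  have hta : t * t * a = 1 := by
    have : Real.sqrt a * Real.sqrt a = a := Real.mul_self_sqrt ha0.le
    have h0 : 0 < Real.sqrt a := Real.sqrt_pos.2 ha0
    rw [ht]
    field_simp
    nlinarith
  refine ⟨n, t • r, ⟨fun v hv => ?_, ?_, Submodule.smul_mem _ _ hr, ?_, ?_⟩⟩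
  · rw [hgn, (mem_tangentSigma_iff hg hs hr hr0 v).1 hv, mul_zero]
  · rw [hgn, hnr, inv_mul_cancel₀ ha0.ne']
  · rw [II_smul_radical, hnn, mul_zero]
  · rw [HRad, II_smul_radical, II_smul_left g hr, II_comm g hr, hnr]
    linarith

/-! ### Components with respect to a main pair -/

variable {n r : TangentSpace (𝓡 m) q}

theorem IsMainPair.II_radical_normal (h : IsMainPair g n r) : II g r r n = 1 := by
  have := h.normalized
  rw [HRad] at this
  linarith

theorem IsMainPair.ne_zero (h : IsMainPair g n r) : r ≠ 0 := by
  rintro rfl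
  have h1 := h.II_radical_normal
  have h2 := II_smul_radical (g := g) 0 (0 : TangentSpace (𝓡 m) q) 0 n
  rw [zero_smul, zero_mul] at h2
  rw [h2] at h1
  exact zero_ne_one h1

/-- The vector `a - II(a,r) n` is tangent to `Σ`, hence orthogonal to `n`. -/
theorem IsMainPair.nu_eq [T2Space M] (hg : IsTransverseRiemannLorentz g) (hs : q ∈ singularSet g)
    (h : IsMainPair g n r) (a : TangentSpace (𝓡 m) q) : nu g n a = II g r a r := by
  have hr := h.radical
  have h1 : a + (-II g r a r) • n ∈ tangentSigma g q := by
    rw [mem_tangentSigma_iff hg hs hr h.ne_zero, II_add_left g hr, II_smul_left g hr,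
      II_comm g hr n r, h.II_radical_normal]
    ring
  have h2 := h.normal _ h1
  rw [map_add, map_smul, h.unit, smul_eq_mul] at h2
  rw [nu, g.symm]
  linarith

theorem IsMainPair.II_radical_radical [T2Space M] (hg : IsTransverseRiemannLorentz g)
    (hs : q ∈ singularSet g) (h : IsMainPair g n r) : II g r r r = 0 :=
  (mem_tangentSigma_iff hg hs h.radical h.ne_zero r).1 (hg.tangent q hs h.radical)

theorem IsMainPair.rho_eq (h : IsMainPair g n r) (a : TangentSpace (𝓡 m) q) :
    rho g n r a = II g r a n := by
  rw [rho, HRad, neg_neg, sub_eq_add_neg, ← neg_smul, II_add_left g h.radical,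
    II_smul_left g h.radical, h.isotropic, mul_zero, add_zero]

theorem IsMainPair.sub_mem_screen [T2Space M] (hg : IsTransverseRiemannLorentz g)
    (hs : q ∈ singularSet g) (h : IsMainPair g n r) (a : TangentSpace (𝓡 m) q) :
    a + (-nu g n a) • n + (-rho g n r a) • r ∈ screen g n r := by
  have hr := h.radical
  constructor
  · rw [mem_tangentSigma_iff hg hs hr h.ne_zero, II_add_left g hr, II_add_left g hr,
      II_smul_left g hr, II_smul_left g hr, h.II_radical_radical hg hs, II_comm g hr n r,
      h.II_radical_normal, h.nu_eq hg hs]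
    ring
  · rw [HRad, II_add_left g hr, II_add_left g hr, II_smul_left g hr, II_smul_left g hr,
      h.isotropic, h.II_radical_normal, h.rho_eq]
    ring

/-- Expand `II` on the screen components `a - ν(a) n - ρ(a) r`, using `II(n,n) = II(r,r) = 0` and
`II(r,n) = 1`. -/
theorem IsMainPair.II_eq_of_IIFlat [T2Space M] (hg : IsTransverseRiemannLorentz g)
    (hf : IIFlat g) (hs : q ∈ singularSet g) (h : IsMainPair g n r) (a b : TangentSpace (𝓡 m) q) :
    II g r a b = nu g n a * rho g n r b + rho g n r a * nu g n b := by
  have hr := h.radical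
  have h1 := hf q hs n r h _ (h.sub_mem_screen hg hs a) _ (h.sub_mem_screen hg hs b)
  simp only [II_add_left g hr, II_add_right g hr, II_smul_left g hr, II_smul_right g hr,
    h.isotropic, h.II_radical_normal, h.II_radical_radical hg hs, II_comm g hr n r,
    II_comm g hr n b, II_comm g hr r b, ← h.rho_eq, ← h.nu_eq hg hs] at h1
  linarith

theorem IsMainPair.Upsilon_eq_of_IIFlat [T2Space M] (hg : IsTransverseRiemannLorentz g)
    (hf : IIFlat g) (hs : q ∈ singularSet g) (h : IsMainPair g n r)
    (a b c d : TangentSpace (𝓡 m) q) :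
    Upsilon g r a b c d = -((nuRhoMatrix g n r a b).det * (nuRhoMatrix g n r c d).det) := by
  simp only [Upsilon, nuRhoMatrix, Matrix.det_fin_two_of, h.II_eq_of_IIFlat hg hf hs]
  ring

theorem IsMainPair.forall_Upsilon_eq_zero_iff [T2Space M] (hg : IsTransverseRiemannLorentz g)
    (hf : IIFlat g) (hs : q ∈ singularSet g) (h : IsMainPair g n r)
    (a b c d : TangentSpace (𝓡 m) q) :
    (∀ e, Upsilon g r e b c d = 0 ∧ Upsilon g r a e c d = 0 ∧ Upsilon g r a b e d = 0 ∧
      Upsilon g r a b c e = 0) ↔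
    ((nuRhoMatrix g n r a b).det = 0 ∧ (nuRhoMatrix g n r c d).det = 0) ∨
      nuRhoMatrix g n r a b = 0 ∨ nuRhoMatrix g n r c d = 0 := by
  have hr := h.radical
  have hnn : nu g n n = 1 := h.unit
  have hnr : nu g n r = 0 := by rw [h.nu_eq hg hs, h.II_radical_radical hg hs]
  have hrn : rho g n r n = 0 := by rw [h.rho_eq, h.isotropic]
  have hrr : rho g n r r = 1 := by rw [h.rho_eq, h.II_radical_normal]
  have hmat : ∀ x y : TangentSpace (𝓡 m) q, nuRhoMatrix g n r x y = 0 ↔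
      nu g n x = 0 ∧ nu g n y = 0 ∧ rho g n r x = 0 ∧ rho g n r y = 0 := by
    intro x y
    rw [← Matrix.ext_iff]
    simp [nuRhoMatrix, Fin.forall_fin_two, and_assoc]
  rw [hmat, hmat]
  simp only [h.Upsilon_eq_of_IIFlat hg hf hs, nuRhoMatrix, Matrix.det_fin_two_of, neg_eq_zero,
    mul_eq_zero]
  constructor
  · intro H
    -- The vectors `n` and `r` have `(ν,ρ)` components `(1,0)` and `(0,1)`. If one determinant is
    -- nonzero, these choices force every entry of the other matrix to vanish.
    have H1 := H n
    have H2 := H r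
    rw [hnn, hrn] at H1
    rw [hnr, hrr] at H2
    simp only [one_mul, mul_one, zero_mul, mul_zero, sub_zero, zero_sub, neg_eq_zero] at H1 H2
    obtain ⟨u1, u2, u3, u4⟩ := H1
    obtain ⟨v1, v2, v3, v4⟩ := H2
    rcases eq_or_ne (nu g n a * rho g n r b - nu g n b * rho g n r a) 0 with hx | hx
    · rcases eq_or_ne (nu g n c * rho g n r d - nu g n d * rho g n r c) 0 with hy | hy
      · exact Or.inl ⟨hx, hy⟩
      · exact Or.inr (Or.inl ⟨v2.resolve_right hy, v1.resolve_right hy, u2.resolve_right hy,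
          u1.resolve_right hy⟩)
    · exact Or.inr (Or.inr ⟨v4.resolve_left hx, v3.resolve_left hx, u4.resolve_left hx,
        u3.resolve_left hx⟩)
  · rintro (⟨h1, h2⟩ | ⟨h1, h2, h3, h4⟩ | ⟨h1, h2, h3, h4⟩) e
    · exact ⟨Or.inr h2, Or.inr h2, Or.inl h1, Or.inl h1⟩
    · simp [h1, h2, h3, h4]
    · simp [h1, h2, h3, h4]

end

section

variable {m : ℕ} {M : Type*} [TopologicalSpace M]
  [ChartedSpace (EuclideanSpace ℝ (Fin m)) M] [IsManifold (𝓡 m) ∞ M]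
  {p q : M} {U : Set M} {A B C D : ∀ p : M, TangentSpace (𝓡 m) p} {f : M → ℝ}
  {g : SymTensor m M}

/-! ### Density of the regular set and gluing -/

/-- On an open subset of `Σ` the determinant would be constantly zero, hence have zero differential.
-/
theorem dense_compl_singularSet (hg : IsTransverseRiemannLorentz g) :
    Dense (singularSet g)ᶜ := by
  refine interior_eq_empty_iff_dense_compl.1 (Set.eq_empty_of_forall_notMem fun q hq => ?_)
  refine mvfderiv_det_gram_ne_zero g hg (p := q) (mem_frameSet q) (interior_subset hq) ?_
  have h : (fun x => (gram g q x).det) =ᶠ[𝓝 q] fun _ => (0 : ℝ) := by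
    filter_upwards [(isOpen_frameSet q).mem_nhds (mem_frameSet (m := m) q),
      isOpen_interior.mem_nhds hq] with x hx hxs
    exact (mem_singularSet_iff g hx).1 (interior_subset hxs)
  rw [mvfderiv_congr h, mvfderiv_const]

theorem eq_of_eventually_eq_off_singularSet (hg : IsTransverseRiemannLorentz g) {f₁ f₂ : M → ℝ}
    (h₁ : ContinuousAt f₁ q) (h₂ : ContinuousAt f₂ q)
    (h : ∀ᶠ x in 𝓝 q, x ∉ singularSet g → f₁ x = f₂ x) : f₁ q = f₂ q := by
  have : (𝓝[(singularSet g)ᶜ] q).NeBot :=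
    mem_closure_iff_nhdsWithin_neBot.1 (dense_compl_singularSet hg q)
  refine tendsto_nhds_unique_of_eventuallyEq (l := 𝓝[(singularSet g)ᶜ] q)
    (h₁.tendsto.mono_left nhdsWithin_le_nhds) (h₂.tendsto.mono_left nhdsWithin_le_nhds) ?_
  exact eventually_nhdsWithin_iff.2 h

/-- By density of the regular set, local extensions agree on overlaps. So the diagonal choice `x ↦ h
x x` coincides near each point with one smooth function. -/
theorem exists_contMDiff_of_local (hg : IsTransverseRiemannLorentz g) {K : M → ℝ}
    (H : ∀ p, ∃ V, IsOpen V ∧ p ∈ V ∧ ∃ h : M → ℝ, ContMDiffOn (𝓡 m) 𝓘(ℝ, ℝ) ∞ h V ∧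
      ∀ x ∈ V, x ∉ singularSet g → h x = K x) :
    ∃ F : M → ℝ, ContMDiff (𝓡 m) 𝓘(ℝ, ℝ) ∞ F ∧ ∀ x, x ∉ singularSet g → F x = K x := by
  choose V hV hpV h hh hK using H
  have hF : ∀ p, ∀ x ∈ V p, h x x = h p x := fun p x hx => by
    refine eq_of_eventually_eq_off_singularSet hg
      ((hh x).continuousOn.continuousAt ((hV x).mem_nhds (hpV x)))
      ((hh p).continuousOn.continuousAt ((hV p).mem_nhds hx)) ?_
    filter_upwards [(hV x).mem_nhds (hpV x), (hV p).mem_nhds hx] with y hy hy' hys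
    rw [hK x y hy hys, hK p y hy' hys]
  refine ⟨fun x => h x x, fun p => ?_, fun x hx => hK x x (hpV x) hx⟩
  refine ((hh p).contMDiffAt ((hV p).mem_nhds (hpV p))).congr_of_eventuallyEq ?_
  filter_upwards [(hV p).mem_nhds (hpV p)] with x hx using hF p x hx

/-! ### The smooth extension of the curvature multiplied by the length of the radical field -/

theorem mvfderiv_pair_self (hU : IsOpen U) (hq : q ∈ U) {R : ∀ p : M, TangentSpace (𝓡 m) p}
    (hR : SmoothFieldOn U R) (hr : R q ∈ radical g q) (v : TangentSpace (𝓡 m) q) :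
    mvfderiv (𝓡 m) (pair g R R) q v = 2 * II g (R q) v (R q) := by
  have hd := hR.diffFieldAt hU hq
  have h1 := dualConn_add_swap g (FiberBundle.extend (EuclideanSpace ℝ (Fin m)) v) R R q
  have h2 := II_eq_dualConn g (diffFieldAt_extend v) hd hd hr
  rw [FiberBundle.extend_apply_self] at h1 h2
  rw [h2, ← h1]
  ring

theorem exists_contMDiffOn_eq_Upsilon (hg : IsTransverseRiemannLorentz g) (hU : IsOpen U)
    {R : ∀ p : M, TangentSpace (𝓡 m) p} (hR : SmoothFieldOn U R)
    (hmain : ∀ q ∈ U, q ∈ singularSet g → ∃ n : TangentSpace (𝓡 m) q, IsMainPair g n (R q))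
    (hA : SmoothFieldOn U A) (hB : SmoothFieldOn U B) (hC : SmoothFieldOn U C)
    (hD : SmoothFieldOn U D) :
    ∃ F : M → ℝ, ContMDiffOn (𝓡 m) 𝓘(ℝ, ℝ) ∞ F U ∧
      (∀ q ∈ U, q ∉ singularSet g → F q = pair g R R q * curvature g A B C D q) ∧
      ∀ q ∈ U, q ∈ singularSet g → F q = Upsilon g (R q) (A q) (B q) (C q) (D q) := by
  classical
  refine ⟨fun q => if q ∈ singularSet g then Upsilon g (R q) (A q) (B q) (C q) (D q)
    else pair g R R q * curvature g A B C D q, fun p hp => ?_, fun q _ hs => if_neg hs,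
    fun q _ hs => if_pos hs⟩
  have hW : IsOpen (U ∩ frameSet m p) := hU.inter (isOpen_frameSet p)
  obtain ⟨V, hV, hpV, hVW, h, hh, hfac⟩ := exists_eq_mul_of_mvfderiv_ne_zero hW
    ⟨hp, mem_frameSet p⟩ ((hR.pair g hR).mono Set.inter_subset_left)
    ((contMDiffOn_det (contMDiffOn_gram g p)).mono Set.inter_subset_right)
    (fun h0 => mvfderiv_det_gram_ne_zero g hg (mem_frameSet p)
      ((mem_singularSet_iff g (mem_frameSet p)).2 h0))
    (fun x hx hx0 => by
      obtain ⟨n, hn⟩ := hmain x hx.1 ((mem_singularSet_iff g hx.2).2 hx0)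
      exact hn.radical _)
  have hVU : V ⊆ U := hVW.trans Set.inter_subset_left
  have hVp : V ⊆ frameSet m p := hVW.trans Set.inter_subset_right
  have hS := contMDiffOn_scaledCurvature g hV hVp (hA.mono hVU) (hB.mono hVU) (hC.mono hVU)
    (hD.mono hVU)
  refine ((((hh.mul hS).contMDiffAt (hV.mem_nhds hpV)).congr_of_eventuallyEq
    ?_).contMDiffWithinAt)
  filter_upwards [hV.mem_nhds hpV] with x hx
  have hxU := hVU hx
  have hxp := hVp hx
  by_cases hs : x ∈ singularSet g
  · rw [if_pos hs]
    obtain ⟨n, hn⟩ := hmain x hxU hs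
    obtain ⟨c, hadj, hc⟩ := exists_adjugate_gram_eq g hxp hn.radical hn.ne_zero
    obtain ⟨v, hv⟩ := exists_II_ne_zero hg hs hn.radical hn.ne_zero
    have h1 := mvfderiv_pair_self hU hxU hR hn.radical v
    have h2 : pair g R R =ᶠ[𝓝 x] fun y => h y * (gram g p y).det := by
      filter_upwards [hV.mem_nhds hx] with y hy using hfac y hy
    rw [mvfderiv_congr h2, mvfderiv_fun_mul (mdifferentiableAt_of_contMDiffOn hh hV hx)
      (mdifferentiableAt_of_contMDiffOn (contMDiffOn_det (contMDiffOn_gram g p))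
        (isOpen_frameSet p) hxp), (mem_singularSet_iff g hxp).1 hs] at h1
    simp only [smul_apply, zero_smul, smul_eq_mul, hc, add_zero] at h1
    -- The differential of `τ = h det G` at a point of `Σ` is `2 II(v,r)` on one side and `h · 2c
    -- II(v,r)` on the other.
    have h3 : h x * c = 1 := by
      apply mul_right_cancel₀ hv
      linarith
    rw [Pi.mul_apply, scaledCurvature_eq_Upsilon g hxp hs (hA.diffFieldAt hU hxU)
      (hB.diffFieldAt hU hxU) (hC.diffFieldAt hU hxU) (hD.diffFieldAt hU hxU) hn.radical hadj,
      ← mul_assoc, h3, one_mul]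
  · rw [if_neg hs, Pi.mul_apply, scaledCurvature_eq g hU hxU hxp hs hA hB hC hD, hfac x hx]
    ring

/-! ### Vector fields along the singular set -/

/-- Prescribing the value on `Σ` is a convex condition, so a partition of unity glues the local
extensions. Off the closed set `Σ` the zero field serves as a local extension. -/
theorem SmoothAlong.exists_isExtension [T2Space M] [SigmaCompactSpace M]
    {A : ∀ p : singularSet g, TangentSpace (𝓡 m) (p : M)} (hA : SmoothAlong g A) :
    ∃ A', IsExtension g A' A := by
  obtain ⟨s, hs⟩ := exists_contMDiffSection_forall_mem_convex_of_local (𝓡 m) (n := ⊤)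
    (F_fiber := EuclideanSpace ℝ (Fin m)) (fun x : M => TangentSpace (𝓡 m) x)
    (fun x => {v | ∀ h : x ∈ singularSet g, v = A ⟨x, h⟩})
    (fun x v hv w hw a b _ _ hab h => by rw [hv h, hw h, ← add_smul, hab, one_smul])
    (fun x => by
      by_cases hx : x ∈ singularSet g
      · obtain ⟨U, hU, hxU, A', hA', he⟩ := hA ⟨x, hx⟩
        exact ⟨U, hU.mem_nhds hxU, A', hA', fun y hy h => he ⟨y, h⟩ hy⟩
      · exact ⟨(singularSet g)ᶜ, (isClosed_singularSet g).isOpen_compl.mem_nhds hx, fun _ => 0,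
          (contMDiff_zeroSection ℝ _).contMDiffOn, fun y hy h => absurd h hy⟩)
  exact ⟨s, s.contMDiff, fun q => hs q q.2⟩

theorem exists_smoothField_eq [T2Space M] (e : TangentSpace (𝓡 m) q) :
    ∃ X : ∀ p : M, TangentSpace (𝓡 m) p, SmoothField X ∧ X q = e := by
  obtain ⟨χ⟩ : Nonempty (SmoothBumpFunction (𝓡 m) q) := inferInstance
  have h1 := smoothFieldOn_sum_frame (p := q) (U := frameSet m q)
    (c := fun i _ => frameCoeff q i q e) subset_rfl (fun i => contMDiffOn_const)
  refine ⟨_, ContMDiffOn.smul_section_of_tsupport χ.contMDiff.contMDiffOn (isOpen_frameSet q)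
    χ.tsupport_subset_chartAt_source h1, ?_⟩
  rw [Pi.smul_apply', χ.eq_one, one_smul]
  exact sum_frameCoeff (mem_frameSet q) e

/-! ### Tensorial operators on vector fields off the singular set -/

variable (g) in
/-- `K` is additive and homogeneous over the smooth functions at the regular points. -/
def IsTensorialOff (K : (∀ p : M, TangentSpace (𝓡 m) p) → M → ℝ) : Prop :=
  ∀ (U : Set M) (X Y : ∀ p : M, TangentSpace (𝓡 m) p) (f : M → ℝ), IsOpen U →
    SmoothFieldOn U X → SmoothFieldOn U Y → ContMDiffOn (𝓡 m) 𝓘(ℝ, ℝ) ∞ f U →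
    ∀ x ∈ U, x ∉ singularSet g → K (X + f • Y) x = K X x + f x * K Y x

theorem isTensorialOff_curvature_first (hB : SmoothField B) (hC : SmoothField C)
    (hD : SmoothField D) : IsTensorialOff g fun X => curvature g X B C D := by
  intro U X Y f hU hX hY hf x hx hs
  have hB := hB.smoothFieldOn (U := U)
  have hC := hC.smoothFieldOn (U := U)
  have hD := hD.smoothFieldOn (U := U)
  dsimp only
  rw [curvature_add_left g hU hx hs hX (hY.smul hf) hB hC hD,
    curvature_smul_left g hU hx hs hf hY hB hC hD]

theorem isTensorialOff_curvature_second (hA : SmoothField A) (hC : SmoothField C)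
    (hD : SmoothField D) : IsTensorialOff g fun X => curvature g A X C D := by
  intro U X Y f hU hX hY hf x hx hs
  have h := isTensorialOff_curvature_first (g := g) hA hC hD U X Y f hU hX hY hf x hx hs
  have hA := hA.smoothFieldOn (U := U)
  have hC := hC.smoothFieldOn (U := U)
  have hD := hD.smoothFieldOn (U := U)
  dsimp only at h ⊢
  rw [curvature_swap_left g hU hx hs hA (hX.add (hY.smul hf)) hC hD, h,
    curvature_swap_left g hU hx hs hA hX hC hD, curvature_swap_left g hU hx hs hA hY hC hD]
  ring

theorem isTensorialOff_curvature_last : IsTensorialOff g fun X => curvature g A B C X := by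
  intro U X Y f _ _ _ _ x _ _
  simp only [curvature, Pi.add_apply, Pi.smul_apply', map_add, map_smul, smul_eq_mul]

theorem isTensorialOff_curvature_third (hA : SmoothField A) (hB : SmoothField B)
    (hD : SmoothField D) : IsTensorialOff g fun X => curvature g A B X D := by
  intro U X Y f hU hX hY hf x hx hs
  have h := isTensorialOff_curvature_last (g := g) (A := A) (B := B) (C := D)
    U X Y f hU hX hY hf x hx hs
  have hA := hA.smoothFieldOn (U := U)
  have hB := hB.smoothFieldOn (U := U)
  have hD := hD.smoothFieldOn (U := U)
  dsimp only at h ⊢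
  rw [curvature_swap_right g hU hx hs hA hB (hX.add (hY.smul hf)) hD, h,
    curvature_swap_right g hU hx hs hA hB hX hD, curvature_swap_right g hU hx hs hA hB hY hD]
  ring

variable (g) in
/-- Near `q` the function `S` is the continuous extension of `det (g_ij) K`. -/
def IsScaledExtension (q : M) (K S : M → ℝ) : Prop :=
  ContinuousAt S q ∧ ∀ᶠ x in 𝓝 q, x ∉ singularSet g → S x = (gram g q x).det * K x

theorem isScaledExtension_scaledCurvature (hU : IsOpen U) (hq : q ∈ U)
    (hA : SmoothFieldOn U A) (hB : SmoothFieldOn U B) (hC : SmoothFieldOn U C)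
    (hD : SmoothFieldOn U D) :
    IsScaledExtension g q (curvature g A B C D) (scaledCurvature g q A B C D) := by
  have hW := hU.inter (isOpen_frameSet (m := m) q)
  have hi : U ∩ frameSet m q ⊆ U := Set.inter_subset_left
  have hn := hW.mem_nhds ⟨hq, mem_frameSet q⟩
  refine ⟨(contMDiffOn_scaledCurvature g hW Set.inter_subset_right (hA.mono hi) (hB.mono hi)
    (hC.mono hi) (hD.mono hi)).continuousOn.continuousAt hn, ?_⟩
  filter_upwards [hn] with x hx hs
  exact scaledCurvature_eq g hU hx.1 hx.2 hs hA hB hC hD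

/-- Necessity in (1): `A' + ψ X`, with `ψ` a cut-off of `det G`, is another extension of `A`. The
two values of `K` differ near `q` by `det G · K X`, that is by `S`, while the limits at `q` agree.
-/
theorem IsTensorialOff.eq_zero_of_extension [T2Space M] (hg : IsTransverseRiemannLorentz g)
    {K : (∀ p : M, TangentSpace (𝓡 m) p) → M → ℝ} (hK : IsTensorialOff g K)
    {A : ∀ p : singularSet g, TangentSpace (𝓡 m) (p : M)}
    {A' X : ∀ p : M, TangentSpace (𝓡 m) p} (hA' : IsExtension g A' A) {L : singularSet g → ℝ}
    (hL : ∀ A', IsExtension g A' A → ∃ F : M → ℝ, ContMDiff (𝓡 m) 𝓘(ℝ, ℝ) ∞ F ∧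
      (∀ x, x ∉ singularSet g → F x = K A' x) ∧ ∀ x : singularSet g, F x = L x)
    (hs : q ∈ singularSet g) (hX : SmoothField X) {S : M → ℝ}
    (hS : IsScaledExtension g q (K X) S) : S q = 0 := by
  obtain ⟨χ⟩ : Nonempty (SmoothBumpFunction (𝓡 m) q) := inferInstance
  set ψ : M → ℝ := fun x => χ x • (gram g q x).det with hψ
  have hψs : ContMDiff (𝓡 m) 𝓘(ℝ, ℝ) ∞ ψ :=
    χ.contMDiff_smul (contMDiffOn_det (contMDiffOn_gram g q))
  have hψ0 : ∀ x ∈ singularSet g, ψ x = 0 := fun x hx => by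
    by_cases hxs : x ∈ frameSet m q
    · simp only [hψ, (mem_singularSet_iff g hxs).1 hx, smul_zero]
    · have : χ x = 0 := by
        by_contra h
        exact hxs (χ.support_subset_source h)
      simp only [hψ, this, zero_smul]
  have hsm : ∀ {Z : ∀ p : M, TangentSpace (𝓡 m) p}, SmoothField Z → SmoothFieldOn Set.univ Z :=
    fun hZ => hZ.smoothFieldOn
  obtain ⟨F₀, hF₀, hF₀K, hF₀L⟩ := hL A' hA'
  obtain ⟨F₁, hF₁, hF₁K, hF₁L⟩ := hL (A' + ψ • X)
    ⟨contMDiffOn_univ.1 ((hsm hA'.1).add ((hsm hX).smul hψs.contMDiffOn)), fun x => by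
      change A' x + ψ x • X x = A x
      rw [hψ0 x x.2, zero_smul, add_zero, hA'.2]⟩
  have h := eq_of_eventually_eq_off_singularSet hg hS.1
    (hF₁.continuous.sub hF₀.continuous).continuousAt (q := q) (by
      filter_upwards [hS.2, χ.eventuallyEq_one] with x hx hχ hxs
      rw [hx hxs, Pi.sub_apply, hF₁K x hxs, hF₀K x hxs, hK Set.univ A' X ψ isOpen_univ (hsm hA'.1) (hsm hX)
        hψs.contMDiffOn x (Set.mem_univ x) hxs]
      simp [hψ, hχ])
  rw [h, Pi.sub_apply, hF₁L ⟨q, hs⟩, hF₀L ⟨q, hs⟩, sub_self]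

/-- Sufficiency in (1), one slot at a time: Hadamard division of the coefficients gives `A'' - A' =
det G · Y` near `q`, so the two values of `K` differ by the scaled operator on `Y`, which tends to
`0` at `q`. -/
theorem IsTensorialOff.eq_of_extension (hg : IsTransverseRiemannLorentz g)
    {K : (∀ p : M, TangentSpace (𝓡 m) p) → M → ℝ} (hK : IsTensorialOff g K)
    {A : ∀ p : singularSet g, TangentSpace (𝓡 m) (p : M)}
    {A' A'' : ∀ p : M, TangentSpace (𝓡 m) p} (hA' : IsExtension g A' A)
    (hA'' : IsExtension g A'' A) {F F' : M → ℝ} (hF : Continuous F) (hF' : Continuous F')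
    (hFK : ∀ x, x ∉ singularSet g → F x = K A' x) (hFK' : ∀ x, x ∉ singularSet g → F' x = K A'' x)
    (hs : q ∈ singularSet g)
    (hS : ∀ V Y, IsOpen V → q ∈ V → SmoothFieldOn V Y →
      ∃ S : M → ℝ, IsScaledExtension g q (K Y) S ∧ S q = 0) : F' q = F q := by
  classical
  have hA1 : SmoothFieldOn (frameSet m q) A' := hA'.1.smoothFieldOn
  have hA2 : SmoothFieldOn (frameSet m q) A'' := hA''.1.smoothFieldOn
  have hdet := contMDiffOn_det (contMDiffOn_gram g q)
  have H : ∀ i, ∃ V, IsOpen V ∧ q ∈ V ∧ V ⊆ frameSet m q ∧ ∃ h : M → ℝ,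
      ContMDiffOn (𝓡 m) 𝓘(ℝ, ℝ) ∞ h V ∧
      ∀ x ∈ V, frameCoeff q i x ((A'' - A') x) = h x * (gram g q x).det := fun i =>
    exists_eq_mul_of_mvfderiv_ne_zero (isOpen_frameSet q) (mem_frameSet q)
      (by simpa using (hA2.sub hA1).frameCoeff (p := q) (isOpen_frameSet q) i) hdet
      (fun _ => mvfderiv_det_gram_ne_zero g hg (mem_frameSet q) hs)
      (fun x hx hx0 => by
        have hxs := (mem_singularSet_iff g hx).2 hx0
        rw [Pi.sub_apply, hA'.2 ⟨x, hxs⟩, hA''.2 ⟨x, hxs⟩, sub_self, map_zero])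
  choose V hV hqV hVs h hh hfac using H
  set W : Set M := frameSet m q ∩ ⋂ i, V i with hW
  have hWo : IsOpen W := (isOpen_frameSet q).inter (isOpen_iInter_of_finite hV)
  have hqW : q ∈ W := ⟨mem_frameSet q, Set.mem_iInter.2 hqV⟩
  have hWV : ∀ i, W ⊆ V i := fun i x hx => Set.mem_iInter.1 hx.2 i
  -- Outside `W` the factor is set to `1` and `Y` to the difference itself. Then `A'' = A' + ψ • Y`
  -- holds on all of `M`, as needed because `K` acts on global fields and is not assumed local.
  obtain ⟨Y, hY⟩ : ∃ Y : ∀ p : M, TangentSpace (𝓡 m) p, ∀ x, Y x =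
      if x ∈ W then ∑ i, h i x • frame q i x else (A'' - A') x := ⟨_, fun _ => rfl⟩
  obtain ⟨ψ, hψ⟩ : ∃ ψ : M → ℝ, ∀ x, ψ x = if x ∈ W then (gram g q x).det else 1 :=
    ⟨_, fun _ => rfl⟩
  have hYs : SmoothFieldOn W Y := by
    refine ContMDiffOn.congr (smoothFieldOn_sum_frame (p := q) (U := W) (c := h)
      Set.inter_subset_left fun i => (hh i).mono (hWV i)) fun x hx => ?_
    rw [hY, if_pos hx]
  have hψs : ContMDiffOn (𝓡 m) 𝓘(ℝ, ℝ) ∞ ψ W :=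
    (hdet.mono Set.inter_subset_left).congr fun x hx => by rw [hψ, if_pos hx]
  have heq : A'' = A' + ψ • Y := by
    funext x
    change A'' x = A' x + ψ x • Y x
    by_cases hx : x ∈ W
    · have h1 := sum_frameCoeff hx.1 ((A'' - A') x)
      rw [hψ, hY, if_pos hx, if_pos hx, Finset.smul_sum, ← sub_eq_iff_eq_add', ← Pi.sub_apply,
        ← h1]
      refine Finset.sum_congr rfl fun i _ => ?_
      rw [hfac i x (hWV i hx), smul_smul, mul_comm]
    · rw [hψ, hY, if_neg hx, if_neg hx, one_smul, Pi.sub_apply, add_sub_cancel]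
  obtain ⟨S, hS, hS0⟩ := hS W Y hWo hqW hYs
  have key := eq_of_eventually_eq_off_singularSet hg (hF'.sub hF).continuousAt hS.1 (q := q) (by
    filter_upwards [hS.2, hWo.mem_nhds hqW] with x hx hxW hxs
    rw [hx hxs, Pi.sub_apply, hFK' x hxs, hFK x hxs, heq, hK W A' Y ψ hWo (hA1.mono Set.inter_subset_left) hYs
      hψs x hxW hxs, hψ, if_pos hxW]
    ring)
  rwa [hS0, Pi.sub_apply, sub_eq_zero] at key

end

section

variable {m : ℕ} {M : Type*} [TopologicalSpace M]
  [ChartedSpace (EuclideanSpace ℝ (Fin m)) M] [IsManifold (𝓡 m) ∞ M]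
  {p q : M} {U : Set M} {A B C D : ∀ p : M, TangentSpace (𝓡 m) p} {f : M → ℝ}
  {g : SymTensor m M}

/-! ### Well-definedness of the curvature along the singular set -/

theorem Upsilon_swap_left (r a b c d : TangentSpace (𝓡 m) q) :
    Upsilon g r b a c d = -Upsilon g r a b c d := by
  simp only [Upsilon, Matrix.det_fin_two_of]
  ring

theorem Upsilon_swap_right (r a b c d : TangentSpace (𝓡 m) q) :
    Upsilon g r a b d c = -Upsilon g r a b c d := by
  simp only [Upsilon, Matrix.det_fin_two_of]
  ring

theorem scaledCurvature_eq_zero_iff (hg : IsTransverseRiemannLorentz g) (hqp : q ∈ frameSet m p)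
    (hs : q ∈ singularSet g) (hA : DiffFieldAt A q) (hB : DiffFieldAt B q) (hC : DiffFieldAt C q)
    (hD : DiffFieldAt D q) {r : TangentSpace (𝓡 m) q} (hr : r ∈ radical g q) (hr0 : r ≠ 0) :
    scaledCurvature g p A B C D q = 0 ↔ Upsilon g r (A q) (B q) (C q) (D q) = 0 := by
  obtain ⟨c, hadj, hc⟩ := exists_adjugate_gram_eq g hqp hr hr0
  rw [scaledCurvature_eq_Upsilon g hqp hs hA hB hC hD hr hadj, mul_eq_zero,
    or_iff_right (adjugate_coeff_ne_zero hg hqp hs hc)]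

/-- The vanishing of `Υ` makes the scaled curvature vanish on `Σ`, hence divisible by `det G`. -/
theorem exists_contMDiff_eq_curvature (hg : IsTransverseRiemannLorentz g) (hA : SmoothField A)
    (hB : SmoothField B) (hC : SmoothField C) (hD : SmoothField D)
    (h : ∀ q ∈ singularSet g, ∃ r ∈ radical g q, r ≠ 0 ∧
      Upsilon g r (A q) (B q) (C q) (D q) = 0) :
    ∃ F : M → ℝ, ContMDiff (𝓡 m) 𝓘(ℝ, ℝ) ∞ F ∧
      ∀ x, x ∉ singularSet g → F x = curvature g A B C D x := by
  refine exists_contMDiff_of_local hg fun p => ?_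
  have hU := isOpen_frameSet (m := m) p
  have sm := fun {X : ∀ p : M, TangentSpace (𝓡 m) p} (hX : SmoothField X) =>
    hX.smoothFieldOn (U := frameSet m p)
  obtain ⟨V, hV, hpV, hVU, h, hh, hfac⟩ := exists_eq_mul_of_mvfderiv_ne_zero hU (mem_frameSet p)
    (contMDiffOn_scaledCurvature g hU subset_rfl (sm hA) (sm hB) (sm hC) (sm hD))
    (contMDiffOn_det (contMDiffOn_gram g p))
    (fun h0 => mvfderiv_det_gram_ne_zero g hg (mem_frameSet p)
      ((mem_singularSet_iff g (mem_frameSet p)).2 h0))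
    (fun x hx hx0 => by
      have hs := (mem_singularSet_iff g hx).2 hx0
      obtain ⟨r, hr, hr0, h0⟩ := h x hs
      exact (scaledCurvature_eq_zero_iff hg hx hs ((sm hA).diffFieldAt hU hx)
        ((sm hB).diffFieldAt hU hx) ((sm hC).diffFieldAt hU hx) ((sm hD).diffFieldAt hU hx)
        hr hr0).2 h0)
  refine ⟨V, hV, hpV, h, hh, fun x hx hs => ?_⟩
  have h1 := hfac x hx
  have h2 : (gram g p x).det ≠ 0 := fun h0 => hs ((mem_singularSet_iff g (hVU hx)).2 h0)
  rw [scaledCurvature_eq g hU (hVU hx) (hVU hx) hs (sm hA) (sm hB) (sm hC) (sm hD), mul_comm] at h1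
  exact (mul_right_cancel₀ h2 h1).symm

section

variable {A B C D : ∀ p : singularSet g, TangentSpace (𝓡 m) (p : M)}

theorem CurvatureWellDefined.swap_left (h : CurvatureWellDefined g A B C D) :
    CurvatureWellDefined g B A C D := by
  obtain ⟨L, hL⟩ := h
  refine ⟨fun q => -L q, fun B' A' C' D' hB hA hC hD => ?_⟩
  obtain ⟨F, hF, hFK, hFL⟩ := hL A' B' C' D' hA hB hC hD
  refine ⟨fun x => -F x, hF.neg, fun x hx => ?_, fun x => congrArg Neg.neg (hFL x)⟩
  dsimp only
  rw [hFK x hx, curvature_swap_left g isOpen_univ (Set.mem_univ x) hx hA.1.smoothFieldOn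
    hB.1.smoothFieldOn hC.1.smoothFieldOn hD.1.smoothFieldOn, neg_neg]

theorem CurvatureWellDefined.swap_right (h : CurvatureWellDefined g A B C D) :
    CurvatureWellDefined g A B D C := by
  obtain ⟨L, hL⟩ := h
  refine ⟨fun q => -L q, fun A' B' D' C' hA hB hD hC => ?_⟩
  obtain ⟨F, hF, hFK, hFL⟩ := hL A' B' C' D' hA hB hC hD
  refine ⟨fun x => -F x, hF.neg, fun x hx => ?_, fun x => congrArg Neg.neg (hFL x)⟩
  dsimp only
  rw [hFK x hx, curvature_swap_right g isOpen_univ (Set.mem_univ x) hx hA.1.smoothFieldOn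
    hB.1.smoothFieldOn hC.1.smoothFieldOn hD.1.smoothFieldOn, neg_neg]

variable [T2Space M] [SigmaCompactSpace M]

theorem CurvatureWellDefined.Upsilon_first (hg : IsTransverseRiemannLorentz g)
    (h : CurvatureWellDefined g A B C D) (hA : SmoothAlong g A) (hB : SmoothAlong g B)
    (hC : SmoothAlong g C) (hD : SmoothAlong g D) (p : singularSet g)
    {r : TangentSpace (𝓡 m) (p : M)} (hr : r ∈ radical g (p : M)) (hr0 : r ≠ 0)
    (e : TangentSpace (𝓡 m) (p : M)) : Upsilon g r e (B p) (C p) (D p) = 0 := by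
  obtain ⟨L, hL⟩ := h
  obtain ⟨A', hA'⟩ := hA.exists_isExtension
  obtain ⟨B', hB'⟩ := hB.exists_isExtension
  obtain ⟨C', hC'⟩ := hC.exists_isExtension
  obtain ⟨D', hD'⟩ := hD.exists_isExtension
  obtain ⟨X, hX, rfl⟩ := exists_smoothField_eq e
  have sm := fun {X : ∀ p : M, TangentSpace (𝓡 m) p} (hX : SmoothField X) =>
    hX.smoothFieldOn (U := Set.univ)
  have df := fun {X : ∀ p : M, TangentSpace (𝓡 m) p} (hX : SmoothField X) =>
    (sm hX).diffFieldAt isOpen_univ (Set.mem_univ (p : M))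
  rw [← hB'.2, ← hC'.2, ← hD'.2, ← scaledCurvature_eq_zero_iff hg (mem_frameSet (p : M)) p.2
    (df hX) (df hB'.1) (df hC'.1) (df hD'.1) hr hr0]
  exact (isTensorialOff_curvature_first hB'.1 hC'.1 hD'.1).eq_zero_of_extension hg hA'
    (fun A' hA' => hL A' B' C' D' hA' hB' hC' hD') p.2 hX
    (isScaledExtension_scaledCurvature isOpen_univ (Set.mem_univ _) (sm hX) (sm hB'.1) (sm hC'.1)
      (sm hD'.1))

theorem CurvatureWellDefined.Upsilon_last (hg : IsTransverseRiemannLorentz g)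
    (h : CurvatureWellDefined g A B C D) (hA : SmoothAlong g A) (hB : SmoothAlong g B)
    (hC : SmoothAlong g C) (hD : SmoothAlong g D) (p : singularSet g)
    {r : TangentSpace (𝓡 m) (p : M)} (hr : r ∈ radical g (p : M)) (hr0 : r ≠ 0)
    (e : TangentSpace (𝓡 m) (p : M)) : Upsilon g r (A p) (B p) (C p) e = 0 := by
  obtain ⟨L, hL⟩ := h
  obtain ⟨A', hA'⟩ := hA.exists_isExtension
  obtain ⟨B', hB'⟩ := hB.exists_isExtension
  obtain ⟨C', hC'⟩ := hC.exists_isExtension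
  obtain ⟨D', hD'⟩ := hD.exists_isExtension
  obtain ⟨X, hX, rfl⟩ := exists_smoothField_eq e
  have sm := fun {X : ∀ p : M, TangentSpace (𝓡 m) p} (hX : SmoothField X) =>
    hX.smoothFieldOn (U := Set.univ)
  have df := fun {X : ∀ p : M, TangentSpace (𝓡 m) p} (hX : SmoothField X) =>
    (sm hX).diffFieldAt isOpen_univ (Set.mem_univ (p : M))
  rw [← hA'.2, ← hB'.2, ← hC'.2, ← scaledCurvature_eq_zero_iff hg (mem_frameSet (p : M)) p.2
    (df hA'.1) (df hB'.1) (df hC'.1) (df hX) hr hr0]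
  exact isTensorialOff_curvature_last.eq_zero_of_extension hg hD'
    (fun D' hD' => hL A' B' C' D' hA' hB' hC' hD') p.2 hX
    (isScaledExtension_scaledCurvature isOpen_univ (Set.mem_univ _) (sm hA'.1) (sm hB'.1)
      (sm hC'.1) (sm hX))

theorem curvatureWellDefined_of_Upsilon (hg : IsTransverseRiemannLorentz g)
    (hA : SmoothAlong g A) (hB : SmoothAlong g B) (hC : SmoothAlong g C) (hD : SmoothAlong g D)
    (h : ∀ (p : singularSet g) (n r : TangentSpace (𝓡 m) (p : M)), IsMainPair g n r →
      ∀ e : TangentSpace (𝓡 m) (p : M),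
        Upsilon g r e (B p) (C p) (D p) = 0 ∧ Upsilon g r (A p) e (C p) (D p) = 0 ∧
        Upsilon g r (A p) (B p) e (D p) = 0 ∧ Upsilon g r (A p) (B p) (C p) e = 0) :
    CurvatureWellDefined g A B C D := by
  have ex : ∀ {A' B' C' D' : ∀ p : M, TangentSpace (𝓡 m) p}, IsExtension g A' A →
      IsExtension g B' B → IsExtension g C' C → IsExtension g D' D →
      ∃ F : M → ℝ, ContMDiff (𝓡 m) 𝓘(ℝ, ℝ) ∞ F ∧
        ∀ x, x ∉ singularSet g → F x = curvature g A' B' C' D' x := by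
    intro A' B' C' D' hA' hB' hC' hD'
    refine exists_contMDiff_eq_curvature hg hA'.1 hB'.1 hC'.1 hD'.1 fun q hq => ?_
    obtain ⟨n, r, hnr⟩ := exists_isMainPair hg hq
    refine ⟨r, hnr.radical, hnr.ne_zero, ?_⟩
    rw [hA'.2 ⟨q, hq⟩, hB'.2 ⟨q, hq⟩, hC'.2 ⟨q, hq⟩, hD'.2 ⟨q, hq⟩]
    exact (h ⟨q, hq⟩ n r hnr _).1
  have zero : ∀ {V : Set M} {X Y Z W : ∀ p : M, TangentSpace (𝓡 m) p} (q : singularSet g),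
      IsOpen V → (q : M) ∈ V → SmoothFieldOn V X → SmoothFieldOn V Y → SmoothFieldOn V Z →
      SmoothFieldOn V W → (∀ n r : TangentSpace (𝓡 m) (q : M), IsMainPair g n r →
        Upsilon g r (X q) (Y q) (Z q) (W q) = 0) →
      ∃ S : M → ℝ, IsScaledExtension g (q : M) (curvature g X Y Z W) S ∧ S q = 0 := by
    intro V X Y Z W q hV hq hX hY hZ hW h0
    obtain ⟨n, r, hnr⟩ := exists_isMainPair hg q.2
    exact ⟨_, isScaledExtension_scaledCurvature hV hq hX hY hZ hW,
      (scaledCurvature_eq_zero_iff hg (mem_frameSet (q : M)) q.2 (hX.diffFieldAt hV hq)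
        (hY.diffFieldAt hV hq) (hZ.diffFieldAt hV hq) (hW.diffFieldAt hV hq) hnr.radical
        hnr.ne_zero).2 (h0 n r hnr)⟩
  obtain ⟨A₀, hA₀⟩ := hA.exists_isExtension
  obtain ⟨B₀, hB₀⟩ := hB.exists_isExtension
  obtain ⟨C₀, hC₀⟩ := hC.exists_isExtension
  obtain ⟨D₀, hD₀⟩ := hD.exists_isExtension
  obtain ⟨F₀, hF₀, hK₀⟩ := ex hA₀ hB₀ hC₀ hD₀
  refine ⟨fun q => F₀ q, fun A' B' C' D' hA' hB' hC' hD' => ?_⟩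
  -- The extensions are exchanged successively in the four slots; each exchange uses the vanishing
  -- of `Υ` with that slot free.
  obtain ⟨F₁, hF₁, hK₁⟩ := ex hA' hB₀ hC₀ hD₀
  obtain ⟨F₂, hF₂, hK₂⟩ := ex hA' hB' hC₀ hD₀
  obtain ⟨F₃, hF₃, hK₃⟩ := ex hA' hB' hC' hD₀
  obtain ⟨F₄, hF₄, hK₄⟩ := ex hA' hB' hC' hD'
  refine ⟨F₄, hF₄, hK₄, fun q => ?_⟩
  have e₁ := (isTensorialOff_curvature_first hB₀.1 hC₀.1 hD₀.1).eq_of_extension hg hA₀ hA'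
    hF₀.continuous hF₁.continuous hK₀ hK₁ q.2 fun V Y hV hq hY =>
      zero q hV hq hY hB₀.1.smoothFieldOn hC₀.1.smoothFieldOn hD₀.1.smoothFieldOn fun n r hnr => by
        rw [hB₀.2, hC₀.2, hD₀.2]
        exact (h q n r hnr _).1
  have e₂ := (isTensorialOff_curvature_second hA'.1 hC₀.1 hD₀.1).eq_of_extension hg hB₀ hB'
    hF₁.continuous hF₂.continuous hK₁ hK₂ q.2 fun V Y hV hq hY =>
      zero q hV hq hA'.1.smoothFieldOn hY hC₀.1.smoothFieldOn hD₀.1.smoothFieldOn fun n r hnr => by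
        rw [hA'.2, hC₀.2, hD₀.2]
        exact (h q n r hnr _).2.1
  have e₃ := (isTensorialOff_curvature_third hA'.1 hB'.1 hD₀.1).eq_of_extension hg hC₀ hC'
    hF₂.continuous hF₃.continuous hK₂ hK₃ q.2 fun V Y hV hq hY =>
      zero q hV hq hA'.1.smoothFieldOn hB'.1.smoothFieldOn hY hD₀.1.smoothFieldOn fun n r hnr => by
        rw [hA'.2, hB'.2, hD₀.2]
        exact (h q n r hnr _).2.2.1
  have e₄ := isTensorialOff_curvature_last.eq_of_extension hg hD₀ hD'
    hF₃.continuous hF₄.continuous hK₃ hK₄ q.2 fun V Y hV hq hY =>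
      zero q hV hq hA'.1.smoothFieldOn hB'.1.smoothFieldOn hC'.1.smoothFieldOn hY fun n r hnr => by
        rw [hA'.2, hB'.2, hC'.2]
        exact (h q n r hnr _).2.2.2
  rw [e₄, e₃, e₂, e₁]

theorem curvatureWellDefined_iff (hg : IsTransverseRiemannLorentz g)
    (hA : SmoothAlong g A) (hB : SmoothAlong g B) (hC : SmoothAlong g C) (hD : SmoothAlong g D) :
    CurvatureWellDefined g A B C D ↔
      ∀ (p : singularSet g) (n r : TangentSpace (𝓡 m) (p : M)), IsMainPair g n r →
        ∀ e : TangentSpace (𝓡 m) (p : M),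
          Upsilon g r e (B p) (C p) (D p) = 0 ∧ Upsilon g r (A p) e (C p) (D p) = 0 ∧
          Upsilon g r (A p) (B p) e (D p) = 0 ∧ Upsilon g r (A p) (B p) (C p) e = 0 := by
  refine ⟨fun h p n r hnr e => ⟨?_, ?_, ?_, ?_⟩, curvatureWellDefined_of_Upsilon hg hA hB hC hD⟩
  · exact h.Upsilon_first hg hA hB hC hD p hnr.radical hnr.ne_zero e
  · rw [Upsilon_swap_left, h.swap_left.Upsilon_first hg hB hA hC hD p hnr.radical hnr.ne_zero e,
      neg_zero]
  · rw [Upsilon_swap_right, h.swap_right.Upsilon_last hg hA hB hD hC p hnr.radical hnr.ne_zero e,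
      neg_zero]
  · exact h.Upsilon_last hg hA hB hC hD p hnr.radical hnr.ne_zero e

end

end

end SingularMetric

/-! ### The three assertions combined -/

theorem mainTheorem3 {m : ℕ} (hm : 2 < m) {M : Type*} [TopologicalSpace M] [T2Space M]
    [SigmaCompactSpace M] [ConnectedSpace M]
    [ChartedSpace (EuclideanSpace ℝ (Fin m)) M] [IsManifold (𝓡 m) ∞ M]
    (g : SingularMetric.SymTensor m M)
    (hg : SingularMetric.IsTransverseRiemannLorentz g) :
    -- `Υ` is the restriction to `Σ` of the smooth extension of `⟨R,R⟩ ⟨R(A,B)C,D⟩`, where the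
    -- vector field `R` is any local extension of the main radical vector field
    (∀ (U : Set M) (R : ∀ q : M, TangentSpace (𝓡 m) q), IsOpen U →
      SingularMetric.SmoothFieldOn U R →
      (∀ q ∈ U, q ∈ SingularMetric.singularSet g →
        ∃ n : TangentSpace (𝓡 m) q, SingularMetric.IsMainPair g n (R q)) →
      ∀ A B C D : ∀ q : M, TangentSpace (𝓡 m) q,
        SingularMetric.SmoothField A → SingularMetric.SmoothField B →
        SingularMetric.SmoothField C → SingularMetric.SmoothField D →
        ∃ F : M → ℝ, ContMDiffOn (𝓡 m) 𝓘(ℝ, ℝ) ∞ F U ∧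
          (∀ q ∈ U, q ∉ SingularMetric.singularSet g →
            F q = SingularMetric.pair g R R q * SingularMetric.curvature g A B C D q) ∧
          ∀ q ∈ U, q ∈ SingularMetric.singularSet g →
            F q = SingularMetric.Upsilon g (R q) (A q) (B q) (C q) (D q)) ∧
    -- the two equivalences
    ∀ A B C D : ∀ p : SingularMetric.singularSet g, TangentSpace (𝓡 m) (p : M),
      SingularMetric.SmoothAlong g A → SingularMetric.SmoothAlong g B →
      SingularMetric.SmoothAlong g C → SingularMetric.SmoothAlong g D →
      (SingularMetric.CurvatureWellDefined g A B C D ↔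
        ∀ (p : SingularMetric.singularSet g) (n r : TangentSpace (𝓡 m) (p : M)),
          SingularMetric.IsMainPair g n r → ∀ e : TangentSpace (𝓡 m) (p : M),
            SingularMetric.Upsilon g r e (B p) (C p) (D p) = 0 ∧
            SingularMetric.Upsilon g r (A p) e (C p) (D p) = 0 ∧
            SingularMetric.Upsilon g r (A p) (B p) e (D p) = 0 ∧
            SingularMetric.Upsilon g r (A p) (B p) (C p) e = 0) ∧
      (SingularMetric.IIFlat g →
        (SingularMetric.CurvatureWellDefined g A B C D ↔
          ∀ (p : SingularMetric.singularSet g) (n r : TangentSpace (𝓡 m) (p : M)),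
            SingularMetric.IsMainPair g n r →
              ((SingularMetric.nuRhoMatrix g n r (A p) (B p)).det = 0 ∧
                (SingularMetric.nuRhoMatrix g n r (C p) (D p)).det = 0) ∨
              SingularMetric.nuRhoMatrix g n r (A p) (B p) = 0 ∨
              SingularMetric.nuRhoMatrix g n r (C p) (D p) = 0)) := by
  refine ⟨fun U R hU hR hmain A B C D hA hB hC hD =>
    SingularMetric.exists_contMDiffOn_eq_Upsilon hg hU hR hmain hA.smoothFieldOn hB.smoothFieldOn
      hC.smoothFieldOn hD.smoothFieldOn, fun A B C D hA hB hC hD =>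
    ⟨SingularMetric.curvatureWellDefined_iff hg hA hB hC hD, fun hf => ?_⟩⟩
  rw [SingularMetric.curvatureWellDefined_iff hg hA hB hC hD]
  exact forall_congr' fun p => forall_congr' fun n => forall_congr' fun r =>
    forall_congr' fun h => h.forall_Upsilon_eq_zero_iff hg hf p.2 _ _ _ _
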